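/- Let $e\ge 2$ and $r\ge 2$ be integers. Let $\mathbf B^\oplus(e,e,r)$ be the monoid with generators $t_i$ ($i\in\mathbb Z/e$) and $s_3,\dots,s_r$, and relations $s_is_js_i=s_js_is_j$ for $|i-j|=1$; $s_is_j=s_js_i$ for $|i-j|>1$; $s_3t_is_3=t_is_3t_i$ for $i\in\mathbb Z/e$; $s_jt_i=t_is_j$ for $i\in\mathbb Z/e$ and $4\le j\le r$; and $t_it_{i-1}=t_jt_{j-1}$ for $i,j\in\mathbb Z/e$. A Garside element of a monoid is an element whose left divisors and right divisors coincide, are finite in number and generate the monoid; the simples are the divisors of the minimal Garside element, that is, of the Garside element that left-divides every Garside element. Let $P^\oplus_{(e,e,r)}(q)=\sum_n a_nq^n$, where $a_n$ is the number of simples of $\mathbf B^\oplus(e,e,r)$ of length $n$ (the length of an element is the number of letters in any word in the generators representing it). Then the number of simples in $\mathbf B^\oplus(e,e,r)$ is finite and equal to $$P^\oplus_{(e,e,r)}(1)=\prod_{k=2}^r\bigl(2(k-1)+e\bigr)=\frac{(2(r-1)+e)!!}{e!!},$$ where $n!!$ denotes $n(n-2)\cdots4\cdot2$ for $n$ even and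 $n(n-2)\cdots5\cdot3$ for $n$ odd. Moreover, if $e>2$, this number is strictly less than $|\mathbf G(e,e,r)|$, where $\mathbf G(e,e,r)$ is the group of $r\times r$ complex monomial matrices (exactly one non-zero entry in each row and each column) whose non-zero entries are $e$-th roots of unity with product $1$. -/

import Mathlib

namespace CorranPicantin

/-- The generators `T_e ∪ S_r`, with `T_e = {t_i | i ∈ ℤ/e}` and `S_r = {s_3, …, s_r}`. -/
inductive Gen (e r : ℕ) : Type
  | t (i : ZMod e) : Gen e r
  | s (j : ℕ) (h3 : 3 ≤ j) (hr : j ≤ r) : Gen e r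

/-- The generator `t_i` as a one-letter word. -/
def tw (e r : ℕ) (i : ZMod e) : FreeMonoid (Gen e r) := FreeMonoid.of (Gen.t i)

/-- The generator `s_j` as a one-letter word. -/
def sw (e r : ℕ) (j : ℕ) (h3 : 3 ≤ j) (hr : j ≤ r) : FreeMonoid (Gen e r) :=
  FreeMonoid.of (Gen.s j h3 hr)

/-- The defining relations of the presentation of type `(e, e, r)`. -/
inductive Rel (e r : ℕ) : FreeMonoid (Gen e r) → FreeMonoid (Gen e r) → Prop
  /-- `s_i s_j s_i = s_j s_i s_j` for `|i - j| = 1`. -/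
  | braid_ss (i j : ℕ) (hi : 3 ≤ i) (hi' : i ≤ r) (hj : 3 ≤ j) (hj' : j ≤ r)
      (h : i + 1 = j ∨ j + 1 = i) :
      Rel e r (sw e r i hi hi' * sw e r j hj hj' * sw e r i hi hi')
        (sw e r j hj hj' * sw e r i hi hi' * sw e r j hj hj')
  /-- `s_i s_j = s_j s_i` for `|i - j| > 1`. -/
  | comm_ss (i j : ℕ) (hi : 3 ≤ i) (hi' : i ≤ r) (hj : 3 ≤ j) (hj' : j ≤ r)
      (h : i + 1 < j ∨ j + 1 < i) :
      Rel e r (sw e r i hi hi' * sw e r j hj hj') (sw e r j hj hj' * sw e r i hi hi')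
  /-- `s_3 t_i s_3 = t_i s_3 t_i` for `i ∈ ℤ/e`. -/
  | braid_st (i : ZMod e) (h : 3 ≤ r) :
      Rel e r (sw e r 3 le_rfl h * tw e r i * sw e r 3 le_rfl h)
        (tw e r i * sw e r 3 le_rfl h * tw e r i)
  /-- `s_j t_i = t_i s_j` for `i ∈ ℤ/e` and `4 ≤ j ≤ r`. -/
  | comm_st (i : ZMod e) (j : ℕ) (h3 : 3 ≤ j) (hr : j ≤ r) (h4 : 4 ≤ j) :
      Rel e r (sw e r j h3 hr * tw e r i) (tw e r i * sw e r j h3 hr)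
  /-- `t_i t_{i-1} = t_j t_{j-1}` for `i, j ∈ ℤ/e`. -/
  | circle (i j : ZMod e) :
      Rel e r (tw e r i * tw e r (i - 1)) (tw e r j * tw e r (j - 1))

/-- The braid monoid `B⊕(e, e, r)`: the monoid with the above presentation. -/
abbrev BraidMonoid (e r : ℕ) : Type := PresentedMonoid (Rel e r)

/-- The length of an element: the number of letters of any word that represents it
(all relations preserve the length of words). -/
def length (e r : ℕ) : BraidMonoid e r →* Multiplicative ℕ :=
  PresentedMonoid.lift (fun _ => Multiplicative.ofAdd 1) (by
    intro a b h
    cases h <;> simp [tw, sw])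

section Garside

variable {M : Type*} [Monoid M]

/-- `x` left-divides `y`. -/
def LeftDvd (x y : M) : Prop := ∃ z, x * z = y

/-- `x` right-divides `y`. -/
def RightDvd (x y : M) : Prop := ∃ z, y = z * x

/-- A Garside element: its left and right divisors coincide, are finite in number and
generate the monoid. -/
structure IsGarsideElement (d : M) : Prop where
  balanced : ∀ x, LeftDvd x d ↔ RightDvd x d
  finite : {x : M | LeftDvd x d}.Finite
  generate : Submonoid.closure {x : M | LeftDvd x d} = ⊤

/-- The minimal Garside element ("the" Garside element `Δ`): a Garside element that divides
every Garside element. -/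
def IsMinimalGarsideElement (d : M) : Prop :=
  IsGarsideElement d ∧ ∀ d' : M, IsGarsideElement d' → LeftDvd d d'

variable (M) in
/-- The simples of `M`: the divisors of the minimal Garside element. (Two minimal Garside
elements would divide each other and so have the same divisors.) -/
def simples : Set M := {x | ∃ d : M, IsMinimalGarsideElement d ∧ LeftDvd x d}

end Garside

/-- The number `a_n` of simples of length `n` in `B⊕(e, e, r)`. -/
noncomputable def numSimplesOfLength (e r n : ℕ) : ℕ :=
  {x ∈ simples (BraidMonoid e r) | length e r x = Multiplicative.ofAdd n}.ncard

/-- The polynomial `∑ a_n q^n`. -/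
noncomputable def simplesPoly (e r : ℕ) : Polynomial ℕ :=
  ∑ᶠ n : ℕ, Polynomial.monomial n (numSimplesOfLength e r n)

/-- The reflection group `G(e, e, r)`: the monomial `r × r` complex matrices whose non-zero
entries are `e`-th roots of unity with product `1`. -/
def reflectionGroup (e r : ℕ) : Set (Matrix (Fin r) (Fin r) ℂ) :=
  {x | (∀ i, ∃! j, x i j ≠ 0) ∧ (∀ j, ∃! i, x i j ≠ 0) ∧
    (∀ i j, x i j ≠ 0 → x i j ^ e = 1) ∧
    ∏ p : Fin r × Fin r with x p.1 p.2 ≠ 0, x p.1 p.2 = 1}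

end CorranPicantin

/-! A simple is built one wire at a time. With `K + 1` wires in place, the wire `K + 2` enters on
the right, moves left, may reach position 1 by some `t_i`, and may then leave it by `t_{i-1}` and
move right again. It can stop at `K + 1` places before the corner, at `e` corners, or at `K + 1`
places after it, so there are `2(K + 1) + e` choices. The product of these numbers over `K < r - 1`
is the formula.

The lists of positions are matched with the left divisors of `delta`, the product of the full turns
of all wires. The generators act partially, on the right, on lists; the action respects the
relations and follows right multiplication of braids (`ev_mul_val`). Acting by `ev r x` on the
trivial list gives back `x` (`actBraid_ev`), so `ev` is injective. The action of `delta` on the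
trivial list does not fail, hence neither does that of a left divisor, which is then represented by
the list it reaches (`leftDvd_delta_iff`). Conversely every position lies on the path of a full
turn, so every list gives a divisor (`ev_dvd`).

That `delta` is the minimal Garside element needs control of common multiples. The presentation is
complete: `a * x = b * y` for atoms `a`, `b` always comes from the one relation between them
(`res_of_atom_mul_eq`), by a cube condition on triples of atoms and induction on length. This gives
left cancellation. Conjugation by `delta` shifts the indices of the `t_i`, so left and right
divisors agree (`balanced_delta`). A Garside element is a multiple of every atom, and `delta`
divides every such element (`delta_dvd_of_atoms_dvd`).

The inequality compares the product, factor by factor, with the lower bound `r! * e ^ (r - 1)` for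
the order of the reflection group. -/

namespace CorranPicantin

/-! ### Completeness of the presentation and left cancellation -/

section Completeness

variable {e r : ℕ}

/-- A generator as an element of the braid monoid. -/
abbrev atom (a : Gen e r) : BraidMonoid e r := PresentedMonoid.of (Rel e r) a

/-- The length of an element as a natural number. -/
def len (x : BraidMonoid e r) : ℕ := (length e r x).toAdd

@[simp] theorem len_one : len (1 : BraidMonoid e r) = 0 := by simp [len]

@[simp] theorem len_mul (x y : BraidMonoid e r) : len (x * y) = len x + len y := by simp [len]

@[simp] theorem len_atom (a : Gen e r) : len (atom a) = 1 := rfl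

/-- Pairs of generators with a commutation relation. -/
def Comm : Gen e r → Gen e r → Prop
  | .t _, .t _ => False
  | .t _, .s j _ _ => 4 ≤ j
  | .s j _ _, .t _ => 4 ≤ j
  | .s i _ _, .s j _ _ => i + 1 < j ∨ j + 1 < i

/-- Pairs of generators with a braid relation. -/
def Braided : Gen e r → Gen e r → Prop
  | .t _, .t _ => False
  | .t _, .s j _ _ => j = 3
  | .s j _ _, .t _ => j = 3
  | .s i _ _, .s j _ _ => i + 1 = j ∨ j + 1 = i

theorem Comm.symm {a b : Gen e r} (h : Comm a b) : Comm b a := by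
  cases a <;> cases b <;> simp_all [Comm]; omega

theorem Braided.symm {a b : Gen e r} (h : Braided a b) : Braided b a := by
  cases a <;> cases b <;> simp_all [Braided]; omega

theorem Comm.eq {a b : Gen e r} (h : Comm a b) : atom a * atom b = atom b * atom a := by
  rcases a with i | ⟨j, h3, hr⟩ <;> rcases b with i' | ⟨j', h3', hr'⟩
  · exact h.elim
  · exact (PresentedMonoid.mk_eq_mk_of_rel (Rel.comm_st i j' h3' hr' h)).symm
  · exact PresentedMonoid.mk_eq_mk_of_rel (Rel.comm_st i' j h3 hr h)
  · exact PresentedMonoid.mk_eq_mk_of_rel (Rel.comm_ss j j' h3 hr h3' hr' h)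

theorem Braided.eq {a b : Gen e r} (h : Braided a b) :
    atom a * atom b * atom a = atom b * atom a * atom b := by
  rcases a with i | ⟨j, h3, hr⟩ <;> rcases b with i' | ⟨j', h3', hr'⟩
  · exact h.elim
  · obtain rfl : j' = 3 := h
    exact (PresentedMonoid.mk_eq_mk_of_rel (Rel.braid_st i hr')).symm
  · obtain rfl : j = 3 := h
    exact PresentedMonoid.mk_eq_mk_of_rel (Rel.braid_st i' hr)
  · exact PresentedMonoid.mk_eq_mk_of_rel (Rel.braid_ss j j' h3 hr h3' hr' h)

theorem circle_eq (i j : ZMod e) :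
    (atom (.t i) * atom (.t (i - 1)) : BraidMonoid e r) = atom (.t j) * atom (.t (j - 1)) :=
  PresentedMonoid.mk_eq_mk_of_rel (Rel.circle i j)

/-- `Res a b x y` says how `a * x = b * y` arises from the relation between the atoms `a`, `b`. -/
inductive Res : Gen e r → Gen e r → BraidMonoid e r → BraidMonoid e r → Prop
  | refl (a x) : Res a a x x
  | comm {a b} (h : Comm a b) (z) : Res a b (atom b * z) (atom a * z)
  | braid {a b} (h : Braided a b) (z) :
      Res a b (atom b * (atom a * z)) (atom a * (atom b * z))
  | circle {i j} (h : i ≠ j) (z) :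
      Res (.t i) (.t j) (atom (.t (i - 1)) * z) (atom (.t (j - 1)) * z)

theorem Res.symm {a b : Gen e r} {x y} (h : Res a b x y) : Res b a y x := by
  cases h with
  | refl => exact .refl _ _
  | comm h z => exact .comm h.symm z
  | braid h z => exact .braid h.symm z
  | circle h z => exact .circle h.symm z

theorem Res.mul_right {a b : Gen e r} {x y} (h : Res a b x y) (w) : Res a b (x * w) (y * w) := by
  cases h with
  | refl => exact .refl _ _
  | comm h z => simpa only [mul_assoc] using Res.comm h (z * w)
  | braid h z => simpa only [mul_assoc] using Res.braid h (z * w)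
  | circle h z => simpa only [mul_assoc] using Res.circle h (z * w)

theorem Comm.irrefl (a : Gen e r) : ¬ Comm a a := by cases a <;> simp [Comm]

theorem Braided.irrefl (a : Gen e r) : ¬ Braided a a := by cases a <;> simp [Braided]

theorem Comm.not_braided {a b : Gen e r} (h : Comm a b) : ¬ Braided a b := by
  cases a <;> cases b <;> simp_all [Braided, Comm] <;> omega

theorem Res.of_eq {a : Gen e r} {x y} (h : Res a a x y) : x = y := by
  cases h with
  | refl => rfl
  | comm h => exact (Comm.irrefl _ h).elim
  | braid h => exact (Braided.irrefl _ h).elim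
  | circle h => exact (h rfl).elim

theorem Res.of_comm {a b : Gen e r} {x y} (h : Res a b x y) (hc : Comm a b) :
    ∃ z, x = atom b * z ∧ y = atom a * z := by
  cases h with
  | refl => exact (Comm.irrefl _ hc).elim
  | comm h z => exact ⟨z, rfl, rfl⟩
  | braid h => exact (hc.not_braided h).elim
  | circle h => exact hc.elim

theorem Res.of_braid {a b : Gen e r} {x y} (h : Res a b x y) (hc : Braided a b) :
    ∃ z, x = atom b * (atom a * z) ∧ y = atom a * (atom b * z) := by
  cases h with
  | refl => exact (Braided.irrefl _ hc).elim
  | braid h z => exact ⟨z, rfl, rfl⟩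
  | comm h => exact (h.not_braided hc).elim
  | circle h => exact hc.elim

theorem Res.of_circle {i j : ZMod e} {x y : BraidMonoid e r} (h : Res (.t i) (.t j) x y)
    (hij : i ≠ j) : ∃ z, x = atom (.t (i - 1)) * z ∧ y = atom (.t (j - 1)) * z := by
  cases h with
  | refl => exact (hij rfl).elim
  | braid h z => exact h.elim
  | comm h => exact h.elim
  | circle h z => exact ⟨z, rfl, rfl⟩

/-- The completeness property for elements of length less than `n`. -/
def ResBelow (e r n : ℕ) : Prop :=
  ∀ (a b : Gen e r) (x y), atom a * x = atom b * y → len x < n → Res a b x y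

theorem len_eq_of_atom_mul_eq {a b : Gen e r} {x y} (h : atom a * x = atom b * y) :
    len x = len y := by
  simpa using congrArg len h

theorem Comm.mul_eq {a b : Gen e r} (h : Comm a b) (z) :
    atom a * (atom b * z) = atom b * (atom a * z) := by
  rw [← mul_assoc, h.eq, mul_assoc]

theorem Braided.mul_eq {a b : Gen e r} (h : Braided a b) (z) :
    atom a * (atom b * (atom a * z)) = atom b * (atom a * (atom b * z)) := by
  simpa only [mul_assoc] using congrArg (· * z) h.eq

theorem circle_mul_eq (i j : ZMod e) (z : BraidMonoid e r) :
    atom (.t i) * (atom (.t (i - 1)) * z) = atom (.t j) * (atom (.t (j - 1)) * z) := by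
  rw [← mul_assoc, circle_eq i j, mul_assoc]

/-- As `c` commutes with both `a` and `b`, it can be moved behind the letters that the relation
between `a` and `b` puts in front of `z` and `z'`. -/
theorem res_of_comm_comm {n : ℕ} (IH : ResBelow e r n) {a b c : Gen e r} {z z'}
    (hac : Comm a c) (hcb : Comm c b) (hw : atom a * z = atom b * z') (hn : len z < n) :
    Res a b (atom c * z) (atom c * z') := by
  cases IH a b z z' hw hn with
  | refl => exact .refl _ _
  | comm h p => rw [hcb.mul_eq, hac.symm.mul_eq]; exact .comm h _
  | braid h p =>
    rw [hcb.mul_eq, hac.symm.mul_eq, hac.symm.mul_eq, hcb.mul_eq]; exact .braid h _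
  | @circle i j h p =>
    have h1 : ∀ k, Comm c (.t k) := by
      intro k; cases c <;> simp_all [Comm]
    rw [(h1 _).mul_eq, (h1 _).mul_eq]; exact .circle h _

theorem comm_or_braided {a b c : Gen e r} (hac : Comm a c) (hcb : Braided c b) :
    Comm a b ∨ Braided a b := by
  cases a <;> cases b <;> cases c <;> simp_all [Comm, Braided] <;> omega

/-- When `a` and `b` are braided, this is the cube condition of type A₃. Repeated use of `IH`
exposes a common tail `u`, after which both sides are rewritten to begin as the relation between `a`
and `b` demands. -/
theorem res_of_comm_braid {n : ℕ} (IH : ResBelow e r n) {a b c : Gen e r} {z z'}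
    (hac : Comm a c) (hcb : Braided c b) (hw : atom a * z = atom b * (atom c * z'))
    (hn : len z < n) : Res a b (atom c * z) (atom c * (atom b * z')) := by
  have hl := len_eq_of_atom_mul_eq hw
  simp only [len_mul, len_atom] at hl
  have R := IH _ _ _ _ hw hn
  rcases comm_or_braided hac hcb with hab | hab
  · obtain ⟨p, rfl, h2⟩ := R.of_comm hab
    obtain ⟨q, rfl, rfl⟩ := (IH _ _ _ _ h2 (by omega)).of_comm hac.symm
    rw [hcb.mul_eq, ← hab.mul_eq, hac.symm.mul_eq]
    exact .comm hab _
  · obtain ⟨p, rfl, h2⟩ := R.of_braid hab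
    obtain ⟨q, rfl, h3⟩ := (IH _ _ _ _ h2 (by omega)).of_comm hac.symm
    simp only [len_mul, len_atom] at hl
    obtain ⟨u, rfl, rfl⟩ := (IH _ _ _ _ h3 (by simp only [len_mul, len_atom] at *; omega)).of_braid
      hcb.symm
    have e1 : atom c * (atom b * (atom a * (atom c * (atom b * u)))) =
        atom b * (atom a * (atom c * (atom b * (atom a * u)))) := by
      rw [hac.mul_eq, hcb.mul_eq, hac.mul_eq, hab.mul_eq]
    have e2 : atom c * (atom b * (atom a * (atom b * (atom c * u)))) =
        atom a * (atom b * (atom c * (atom b * (atom a * u)))) := by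
      rw [← hab.mul_eq, hac.symm.mul_eq, hac.mul_eq u, hcb.mul_eq]
    rw [e1, e2]
    exact .braid hab _

theorem eq_or_comm_or_circle {a b c : Gen e r} (hac : Braided a c) (hcb : Braided c b) :
    a = b ∨ Comm a b ∨ ∃ i j, i ≠ j ∧ a = .t i ∧ b = .t j := by
  rcases a with i | ⟨j, h3, hr⟩ <;> rcases b with i' | ⟨j', h3', hr'⟩ <;>
    rcases c with k | ⟨k, h3'', hr''⟩ <;> simp_all [Comm, Braided] <;> grind

/-- If `a` and `b` commute, this is again type A₃, with `c` as the middle node. The case foreign to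
Artin monoids is `a = t_i`, `b = t_j`, `c = s_3`. -/
theorem res_of_braid_braid {n : ℕ} (IH : ResBelow e r n) {a b c : Gen e r} {z z'}
    (hac : Braided a c) (hcb : Braided c b)
    (hw : atom a * (atom c * z) = atom b * (atom c * z')) (hn : len z + 1 < n) :
    Res a b (atom c * (atom a * z)) (atom c * (atom b * z')) := by
  have R := IH _ _ _ _ hw (by simp; omega)
  rcases eq_or_comm_or_circle hac hcb with rfl | hab | ⟨i, j, hij, rfl, rfl⟩
  · rw [(IH _ _ _ _ R.of_eq (by omega)).of_eq]
    exact .refl _ _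
  · obtain ⟨w, h1, h2⟩ := R.of_comm hab
    have l1 := len_eq_of_atom_mul_eq h1
    have l2 := len_eq_of_atom_mul_eq h2
    obtain ⟨u, rfl, rfl⟩ := (IH _ _ _ _ h1 (by omega)).of_braid hcb
    obtain ⟨v, rfl, h3⟩ := (IH _ _ _ _ h2 (by simp at *; omega)).of_braid hac.symm
    simp only [len_mul, len_atom] at *
    have h4 := (IH _ _ _ _ h3 (by simp; omega)).of_eq
    obtain ⟨p, rfl, rfl⟩ := (IH _ _ _ _ h4 (by omega)).of_comm hab.symm
    have e1 : atom c * (atom a * (atom b * (atom c * (atom a * p)))) =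
        atom b * (atom c * (atom b * (atom a * (atom c * p)))) := by
      rw [hab.mul_eq, hac.mul_eq, hcb.mul_eq]
    have e2 : atom c * (atom b * (atom a * (atom c * (atom b * p)))) =
        atom a * (atom c * (atom b * (atom a * (atom c * p)))) := by
      rw [hab.symm.mul_eq, ← hcb.mul_eq, ← hac.mul_eq, hab.mul_eq]
    rw [e1, e2]
    exact .comm hab _
  · obtain ⟨w, h1, h2⟩ := R.of_circle hij
    have hct : ∀ k, Braided (.t k) c := by
      intro k; cases c <;> simp_all [Braided]
    have l1 := len_eq_of_atom_mul_eq h1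
    have l2 := len_eq_of_atom_mul_eq h2
    obtain ⟨u, rfl, rfl⟩ := (IH _ _ _ _ h1 (by omega)).of_braid (hct _).symm
    obtain ⟨v, rfl, h3⟩ := (IH _ _ _ _ h2 (by simp at *; omega)).of_braid (hct _).symm
    simp only [len_mul, len_atom] at *
    have h4 := (IH _ _ _ _ h3 (by simp; omega)).of_eq
    obtain ⟨p, rfl, rfl⟩ := (IH _ _ _ _ h4 (by omega)).of_circle (by simpa using hij)
    -- The right side depends on `i` only through its first letter. With the second index set to 0
    -- for both `i` and `j`, the tails coincide, as the circle relation requires.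
    have e1 : ∀ i j, atom c * (atom (.t i) * (atom (.t (i - 1)) *
          (atom c * (atom (.t (i - 1 - 1)) * p)))) =
        atom (.t (i - 1)) * (atom c * (atom (.t j) * (atom (.t (j - 1)) * (atom c * p)))) := by
      intro i j
      rw [circle_mul_eq i (i - 1), (hct (i - 1 - 1)).mul_eq, (hct (i - 1)).symm.mul_eq,
        circle_mul_eq (i - 1) j]
    rw [e1 i 0, e1 j 0]
    exact .circle hij _

theorem res_of_comm_circle {n : ℕ} (IH : ResBelow e r n) {a : Gen e r} {i j : ZMod e} {z z'}
    (hac : Comm a (.t i)) (hw : atom a * z = atom (.t (i - 1)) * z') (hn : len z < n) :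
    Res a (.t j) (atom (.t i) * z) (atom (.t (j - 1)) * z') := by
  have hat : ∀ k, Comm a (.t k) := by
    intro k; cases a <;> simp_all [Comm]
  obtain ⟨p, rfl, rfl⟩ := (IH _ _ _ _ hw hn).of_comm (hat _)
  rw [circle_mul_eq i j, (hat _).symm.mul_eq]
  exact .comm (hat _) _

theorem res_of_braid_circle {n : ℕ} (IH : ResBelow e r n) {a : Gen e r} {i j : ZMod e} {z z'}
    (hac : Braided a (.t i)) (hw : atom a * (atom (.t i) * z) = atom (.t (i - 1)) * z')
    (hn : len z + 1 < n) [Nontrivial (ZMod e)] :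
    Res a (.t j) (atom (.t i) * (atom a * z)) (atom (.t (j - 1)) * z') := by
  have hat : ∀ k, Braided a (.t k) := by
    intro k; cases a <;> simp_all [Braided]
  obtain ⟨p, h1, rfl⟩ := (IH _ _ _ _ hw (by simp; omega)).of_braid (hat _)
  have l1 := len_eq_of_atom_mul_eq h1
  -- Neighbouring indices differ because `ZMod e` is not trivial.
  have hii : i ≠ i - 1 := fun h => one_ne_zero (α := ZMod e) (by linear_combination h)
  obtain ⟨q, rfl, h2⟩ := (IH _ _ _ _ h1 (by omega)).of_circle hii
  simp only [len_mul, len_atom] at *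
  obtain ⟨k, rfl, rfl⟩ := (IH _ _ _ _ h2 (by omega)).of_braid (hat _)
  have e1 : atom (.t i) * (atom a * (atom (.t (i - 1)) * (atom a * (atom (.t (i - 1 - 1)) * k)))) =
      atom (.t j) * (atom a * (atom (.t (j - 1)) * (atom a * (atom (.t (j - 1 - 1)) * k)))) := by
    rw [(hat (i - 1)).mul_eq, (hat (j - 1)).mul_eq, circle_mul_eq i j,
      circle_mul_eq (i - 1) (j - 1)]
  have e2 : atom (.t (j - 1)) * (atom a * (atom (.t (i - 1)) *
      (atom (.t (i - 1 - 1)) * (atom a * k)))) =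
      atom a * (atom (.t j) * (atom (.t (j - 1)) * (atom a * (atom (.t (j - 1 - 1)) * k)))) := by
    rw [circle_mul_eq (i - 1) (j - 1), (hat (j - 1)).symm.mul_eq, circle_mul_eq j (j - 1),
      (hat (j - 1 - 1)).symm.mul_eq]
  rw [e1, e2]
  exact .braid (hat j) _

/-- The cube condition. -/
theorem Res.trans {n : ℕ} (IH : ResBelow e r n) {a b c : Gen e r} {x y w w'}
    [Nontrivial (ZMod e)] (h1 : Res a c x w) (h2 : Res c b w' y) (hw : w = w') (hn : len w ≤ n) :
    Res a b x y := by
  cases h1 with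
  | refl => subst hw; exact h2
  | comm hac z =>
    cases h2 with
    | refl => subst hw; exact .comm hac _
    | comm hcb z' => exact res_of_comm_comm IH hac hcb hw (by simp at hn; omega)
    | braid hcb z' => exact res_of_comm_braid IH hac hcb hw (by simp at hn; omega)
    | circle hij z' => exact res_of_comm_circle IH hac hw (by simp at hn; omega)
  | braid hac z =>
    cases h2 with
    | refl => subst hw; exact .braid hac _
    | comm hcb z' =>
      exact (res_of_comm_braid IH hcb.symm hac.symm hw.symm (by rw [hw] at hn; simp at hn; omega)).symm
    | braid hcb z' => exact res_of_braid_braid IH hac hcb hw (by simp at hn; omega)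
    | circle hij z' => exact res_of_braid_circle IH hac hw (by simp at hn; omega)
  | circle hij z =>
    cases h2 with
    | refl => subst hw; exact .circle hij _
    | comm hcb z' =>
      exact (res_of_comm_circle IH hcb.symm hw.symm (by rw [hw] at hn; simp at hn; omega)).symm
    | braid hcb z' =>
      exact (res_of_braid_circle IH hcb.symm hw.symm (by rw [hw] at hn; simp at hn; omega)).symm
    | @circle _ k hkj z' =>
      have := (IH _ _ _ _ hw (by simp at hn; omega)).of_eq
      subst this
      rename_i i _
      by_cases hik : i = k
      · subst hik; exact .refl _ _
      · exact .circle hik _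

theorem len_mk (u : FreeMonoid (Gen e r)) : len (PresentedMonoid.mk (Rel e r) u) = u.length := by
  induction u using FreeMonoid.inductionOn with
  | one => simp
  | of a => rfl
  | mul u v hu hv => simp [hu, hv]

theorem freeMonoid_of_mul_inj {α : Type*} {a b : α} {u v : FreeMonoid α}
    (h : FreeMonoid.of a * u = FreeMonoid.of b * v) : a = b ∧ u = v :=
  List.cons.inj h

theorem res_of_rel {u v : FreeMonoid (Gen e r)} (h : Rel e r u v) {a b u' v'}
    (hu : u = FreeMonoid.of a * u') (hv : v = FreeMonoid.of b * v') :
    Res a b (PresentedMonoid.mk (Rel e r) u') (PresentedMonoid.mk (Rel e r) v') := by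
  cases h with
  | braid_ss i j hi hi' hj hj' h =>
    simp only [sw, mul_assoc] at hu hv
    obtain ⟨rfl, rfl⟩ := freeMonoid_of_mul_inj hu
    obtain ⟨rfl, rfl⟩ := freeMonoid_of_mul_inj hv
    exact Res.braid (a := .s i hi hi') (b := .s j hj hj') h 1
  | comm_ss i j hi hi' hj hj' h =>
    simp only [sw] at hu hv
    obtain ⟨rfl, rfl⟩ := freeMonoid_of_mul_inj hu
    obtain ⟨rfl, rfl⟩ := freeMonoid_of_mul_inj hv
    exact Res.comm (a := .s i hi hi') (b := .s j hj hj') h 1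
  | braid_st i h =>
    simp only [sw, tw, mul_assoc] at hu hv
    obtain ⟨rfl, rfl⟩ := freeMonoid_of_mul_inj hu
    obtain ⟨rfl, rfl⟩ := freeMonoid_of_mul_inj hv
    exact Res.braid (a := .s 3 le_rfl h) (b := .t i) rfl 1
  | comm_st i j h3 hr h4 =>
    simp only [sw, tw] at hu hv
    obtain ⟨rfl, rfl⟩ := freeMonoid_of_mul_inj hu
    obtain ⟨rfl, rfl⟩ := freeMonoid_of_mul_inj hv
    exact Res.comm (a := .s j h3 hr) (b := .t i) h4 1
  | circle i j =>
    simp only [tw] at hu hv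
    obtain ⟨rfl, rfl⟩ := freeMonoid_of_mul_inj hu
    obtain ⟨rfl, rfl⟩ := freeMonoid_of_mul_inj hv
    by_cases hij : i = j
    · subst hij; exact .refl _ _
    · exact Res.circle (r := r) hij 1

/-- Induction on a derivation of the congruence. Transitivity is the cube condition at the first
letter of the middle word; in a product the first letters come from the left factors unless these
are empty. The bound `n + 1` leaves at most `n` letters after the first, as `Res.trans` asks. -/
theorem res_of_conGen_rel [Nontrivial (ZMod e)] {n : ℕ} (IH : ResBelow e r n)
    {u v : FreeMonoid (Gen e r)}
    (h : ConGen.Rel (Rel e r) u v) : ∀ {a b u' v'}, u.length ≤ n + 1 →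
      u = FreeMonoid.of a * u' → v = FreeMonoid.of b * v' →
      Res a b (PresentedMonoid.mk (Rel e r) u') (PresentedMonoid.mk (Rel e r) v') := by
  have hlen : ∀ {u v}, ConGen.Rel (Rel e r) u v → u.length = v.length := by
    intro u v h
    rw [← len_mk, ← len_mk, PresentedMonoid.mk_eq_mk_iff.2 h]
  induction h with
  | of u v h => exact fun _ hu hv => res_of_rel h hu hv
  | refl u =>
    intro a b u' v' _ hu hv
    obtain ⟨rfl, rfl⟩ := freeMonoid_of_mul_inj (hu.symm.trans hv)
    exact .refl _ _
  | symm h ih => exact fun hl hu hv => (ih (hlen h ▸ hl) hv hu).symm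
  | @trans u w v h1 h2 ih1 ih2 =>
    intro a b u' v' hl hu hv
    have hl1 := hlen h1
    induction w using FreeMonoid.casesOn with
    | one => simp [hu] at hl1
    | of_mul c w' =>
      refine (ih1 hl hu rfl).trans IH (ih2 (hl1 ▸ hl) rfl hv) rfl ?_
      rw [len_mk]
      simp at hl1
      omega
  | @mul u1 v1 u2 v2 h1 h2 ih1 ih2 =>
    intro a b u' v' hl hu hv
    have hl1 := hlen h1
    simp only [FreeMonoid.length_mul] at hl
    induction u1 using FreeMonoid.casesOn with
    | one =>
      have : v1 = 1 := FreeMonoid.length_eq_zero.1 hl1.symm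
      subst this
      exact ih2 (by omega) (by simpa using hu) (by simpa using hv)
    | of_mul c w =>
      induction v1 using FreeMonoid.casesOn with
      | one => simp at hl1
      | of_mul d w' =>
        rw [mul_assoc] at hu hv
        obtain ⟨rfl, rfl⟩ := freeMonoid_of_mul_inj hu
        obtain ⟨rfl, rfl⟩ := freeMonoid_of_mul_inj hv
        have := (ih1 (by omega) rfl rfl).mul_right (PresentedMonoid.mk (Rel e r) u2)
        simpa only [map_mul, PresentedMonoid.mk_eq_mk_iff.2 h2] using this

/-- Completeness of the presentation: an equality between two elements with given first letters
comes from the defining relation between these letters. -/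
theorem res_of_atom_mul_eq [Nontrivial (ZMod e)] {a b : Gen e r} {x y}
    (h : atom a * x = atom b * y) : Res a b x y := by
  have key : ∀ n, ResBelow e r n := by
    intro n
    induction n with
    | zero => exact fun _ _ _ _ _ hn => absurd hn (Nat.not_lt_zero _)
    | succ n IH =>
      intro a b x y h hn
      induction x using PresentedMonoid.inductionOn with | _ u
      induction y using PresentedMonoid.inductionOn with | _ v
      refine res_of_conGen_rel IH (u := FreeMonoid.of a * u)
        (v := FreeMonoid.of b * v) (PresentedMonoid.mk_eq_mk_iff.1 h) ?_ rfl rfl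
      rw [len_mk] at hn
      simp
      omega
  exact key _ a b x y h (Nat.lt_succ_self _)

theorem atom_induction {p : BraidMonoid e r → Prop} (one : p 1)
    (mul : ∀ a x, p x → p (atom a * x)) (x) : p x := by
  induction x using PresentedMonoid.inductionOn with | _ u
  induction u using FreeMonoid.inductionOn' with
  | one => exact one
  | of_mul a u ih => exact mul a _ ih

theorem mul_left_cancel_braid [Nontrivial (ZMod e)] {x y z : BraidMonoid e r}
    (h : x * y = x * z) : y = z := by
  induction x using atom_induction with
  | one => simpa using h
  | mul a x ih =>
    rw [mul_assoc, mul_assoc] at h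
    exact ih (res_of_atom_mul_eq h).of_eq

end Completeness

/-! ### A partial action of the generators on lists of wire positions -/

section Action

variable {e : ℕ}

/-- Generators in unbounded rank; `s n` stands for `s_{n+3}`. -/
inductive Letter (e : ℕ) : Type
  | t (i : ZMod e)
  | s (n : ℕ)

/-- The positions of the last wire in a simple braid: at position `n + 2` before or after its
visit at position `1`, or at position `1`. -/
inductive Pos (e : ℕ) : Type
  | left (n : ℕ)
  | corner (i : ZMod e)
  | right (n : ℕ)
  deriving DecidableEq

open Letter Pos

/-- The partial right action of the generators on simple braids. -/
def act : List (Pos e) → Letter e → Option (List (Pos e))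
  | [], _ => none
  | left n :: x, t i => if n = 0 then some (corner i :: x) else (act x (t i)).map (left n :: ·)
  | left n :: x, s m =>
    if m + 1 = n then some (left m :: x) else if m = n then none
    -- A letter that misses the last wire acts on the other wires; to the right of the last wire its
    -- index drops by one.
    else if m < n then (act x (s m)).map (left n :: ·) else (act x (s (m - 1))).map (left n :: ·)
  | corner i :: x, t j => if j = i - 1 then some (right 0 :: x) else none
  | corner i :: x, s m =>
    -- Behind a wire at the corner `i`, the letter `s_3` acts on the other wires as `t_i`; compare
    -- `evPos_corner_mul_S_zero`.
    if m = 0 then (act x (t i)).map (corner i :: ·) else (act x (s (m - 1))).map (corner i :: ·)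
  -- Passing a wire that has returned from the corner raises the index by one; compare
  -- `evPos_right_mul_T`.
  | right n :: x, t j => if n = 0 then none else (act x (t (j + 1))).map (right n :: ·)
  | right n :: x, s m =>
    if m = n then some (right (n + 1) :: x) else if m + 1 = n then none
    else if m < n then (act x (s m)).map (right n :: ·) else (act x (s (m - 1))).map (right n :: ·)

/-- The partial right action of words. -/
def run (x : List (Pos e)) : List (Letter e) → Option (List (Pos e))
  | [] => some x
  | a :: w => (act x a).bind (run · w)

@[simp] theorem run_nil_cons (a : Letter e) (w) : run [] (a :: w) = none := by
  simp [run, act]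

/-- When no letter of `w` moves the last wire, a relation reduces to its translate by `f` on the
remaining wires. The inductions that verify the relations rest on this. -/
theorem run_cons_of_forall {q : Pos e} (f : Letter e → Letter e) :
    ∀ (w : List (Letter e)) (x : List (Pos e)),
      (∀ a ∈ w, ∀ y, act (q :: y) a = (act y (f a)).map (q :: ·)) →
      run (q :: x) w = (run x (w.map f)).map (q :: ·)
  | [], x, _ => rfl
  | a :: w, x, h => by
    have ih := fun y => run_cons_of_forall f w y fun b hb => h b (List.mem_cons_of_mem _ hb)
    simp only [run, List.map_cons, h a List.mem_cons_self, Option.bind_map, Option.map_bind]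
    exact congrArg _ (funext ih)

theorem run_braid_st [Nontrivial (ZMod e)] (x : List (Pos e)) : ∀ i,
    run x [s 0, t i, s 0] = run x [t i, s 0, t i] := by
  have hi : ∀ i : ZMod e, i ≠ i - 1 :=
    fun i h => one_ne_zero (α := ZMod e) (by linear_combination h)
  induction x with
  | nil => simp
  | cons q x ih =>
    intro i
    rcases q with (_ | _ | k) | j | (_ | _ | k)
    -- Both sides fail: the last wire cannot leave the corner `i` by `t i`, since `i ≠ i - 1`.
    · cases ho : act x (t i) <;> simp [run, act, ho, hi i]
    · cases ho : act x (t i) <;> simp [run, act, ho]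
    · rw [run_cons_of_forall id, run_cons_of_forall id]
      · simp [ih i]
      all_goals simp [act]
    · by_cases h : i = j - 1 <;> cases ho : act x (t j) <;> simp [run, act, h, ho]
    · simp [run, act]
    · cases ho : act x (t (i + 1)) <;> simp [run, act, ho]
    · rw [run_cons_of_forall (fun | t i => t (i + 1) | s m => s m),
          run_cons_of_forall (fun | t i => t (i + 1) | s m => s m)]
      · simp [ih (i + 1)]
      all_goals simp [act]

theorem run_comm_st (x : List (Pos e)) : ∀ n i,
    run x [s (n + 1), t i] = run x [t i, s (n + 1)] := by
  induction x with
  | nil => simp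
  | cons q x ih =>
    intro n i
    rcases q with (_ | k) | j | (_ | k)
    · cases ho : act x (s n) <;> simp [run, act, ho]
    · rcases (show n = k ∨ n + 1 = k ∨ n + 1 < k ∨ k < n by omega) with rfl | rfl | h | h
      · cases ho : act x (t i) <;> simp [run, act, ho]
      · cases ho : act x (t i) <;> simp [run, act, ho]
      · rw [run_cons_of_forall id, run_cons_of_forall id]
        · simp [ih n]
        all_goals simp [act]; grind
      · obtain ⟨n, rfl⟩ : ∃ m', n = m' + 1 := ⟨n - 1, by omega⟩
        rw [run_cons_of_forall (fun | t i => t i | s m => s (m - 1)),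
          run_cons_of_forall (fun | t i => t i | s m => s (m - 1))]
        · simp [ih n]
        all_goals simp [act]; grind
    · by_cases h : i = j - 1 <;> cases ho : act x (s n) <;> simp [run, act, h, ho]
    · cases ho : act x (s n) <;> simp [run, act, ho]
    · rcases (show n = k ∨ n + 1 = k ∨ n + 1 < k ∨ k < n by omega) with rfl | rfl | h | h
      · cases ho : act x (t (i + 1)) <;> simp [run, act, ho]
      · cases ho : act x (t (i + 1)) <;> simp [run, act, ho]
      · rw [run_cons_of_forall (fun | t i => t (i + 1) | s m => s m),
          run_cons_of_forall (fun | t i => t (i + 1) | s m => s m)]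
        · simp [ih n]
        all_goals simp [act]; grind
      · obtain ⟨n, rfl⟩ : ∃ m', n = m' + 1 := ⟨n - 1, by omega⟩
        rw [run_cons_of_forall (fun | t i => t (i + 1) | s m => s (m - 1)),
          run_cons_of_forall (fun | t i => t (i + 1) | s m => s (m - 1))]
        · simp [ih n]
        all_goals simp [act]; grind

theorem run_braid_ss [Nontrivial (ZMod e)] (x : List (Pos e)) : ∀ n,
    run x [s n, s (n + 1), s n] = run x [s (n + 1), s n, s (n + 1)] := by
  induction x with
  | nil => simp
  | cons q x ih =>
    intro n
    have h1 : n + 1 + 1 ≠ n := by omega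
    rcases q with k | i | k
    · rcases lt_trichotomy k n with h | rfl | h
      · obtain ⟨n, rfl⟩ : ∃ m, n = m + 1 := ⟨n - 1, by omega⟩
        rw [run_cons_of_forall (fun | t i => t i | s m => s (m - 1)),
          run_cons_of_forall (fun | t i => t i | s m => s (m - 1))]
        · simp [ih n]
        all_goals simp [act]; grind
      · simp [run, act, h1, Option.bind_map]
      · rcases (show k = n + 1 ∨ k = n + 2 ∨ n + 2 < k by omega) with rfl | rfl | h
        · cases ho : act x (s n) <;> simp [run, act, ho, h1]
        · cases ho : act x (s n) <;> simp [run, act, ho, h1]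
        · rw [run_cons_of_forall id, run_cons_of_forall id]
          · simp [ih n]
          all_goals simp [act]; grind
    · rcases n with _ | n
      -- Behind the corner `i`, the letters `s 0` and `s 1` become `t i` and `s 0`, so the relation
      -- turns into the mixed braid relation.
      · rw [run_cons_of_forall (fun | t i => t i | s 0 => t i | s (m + 1) => s m),
          run_cons_of_forall (fun | t i => t i | s 0 => t i | s (m + 1) => s m)]
        · simp [run_braid_st x i]
        all_goals simp [act]
      · rw [run_cons_of_forall (fun | t i => t i | s m => s (m - 1)),
          run_cons_of_forall (fun | t i => t i | s m => s (m - 1))]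
        · simp [ih n]
        all_goals simp [act]
    · rcases lt_trichotomy k n with h | rfl | h
      · obtain ⟨n, rfl⟩ : ∃ m, n = m + 1 := ⟨n - 1, by omega⟩
        rw [run_cons_of_forall (fun | t i => t i | s m => s (m - 1)),
          run_cons_of_forall (fun | t i => t i | s m => s (m - 1))]
        · simp [ih n]
        all_goals simp [act]; grind
      · cases ho : act x (s k) <;> simp [run, act, ho, h1, h1.symm]
      · rcases (show k = n + 1 ∨ k = n + 2 ∨ n + 2 < k by omega) with rfl | rfl | h
        · cases ho : act x (s n) <;> simp [run, act, ho, h1.symm]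
        · cases ho : act x (s n) <;> simp [run, act, ho]
        · rw [run_cons_of_forall id, run_cons_of_forall id]
          · simp [ih n]
          all_goals simp [act]; grind

theorem run_comm_ss (x : List (Pos e)) : ∀ m n, m + 1 < n →
    run x [s m, s n] = run x [s n, s m] := by
  induction x with
  | nil => simp
  | cons q x ih =>
    intro m n h
    obtain ⟨n, rfl⟩ : ∃ n', n = n' + 1 := ⟨n - 1, by omega⟩
    have h1 : n + 1 ≠ m := by omega
    have h2 : n ≠ m := by omega
    have h3 : ¬ n < m := by omega
    have h4 : ¬ n + 1 < m := by omega
    have h5 : m < n := by omega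
    have h6 : n + 1 + 1 ≠ m := by omega
    have h7 : m ≠ n + 2 := by omega
    have h8 : m ≤ n := by omega
    rcases q with k | i | k
    · rcases lt_trichotomy k m with hk | rfl | hk
      · obtain ⟨m, rfl⟩ : ∃ m', m = m' + 1 := ⟨m - 1, by omega⟩
        rw [run_cons_of_forall (fun | t i => t i | s m => s (m - 1)),
          run_cons_of_forall (fun | t i => t i | s m => s (m - 1))]
        · simp [ih m n (by omega)]
        all_goals simp [act]; grind
      · cases ho : act x (s n) <;> simp [run, act, *, Ne.symm]
      · rcases (show k = m + 1 ∨ m + 1 < k by omega) with rfl | h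
        · cases ho : act x (s n) <;> simp [run, act, *, Ne.symm]
        · rcases (show k < n + 1 ∨ k = n + 1 ∨ k = n + 2 ∨ n + 2 < k by omega) with hk | rfl | rfl | hk
          -- The last wire lies between the two letters, so only the larger index drops.
          · rw [run_cons_of_forall (fun | t i => t i | s l => if l = m then s l else s (l - 1)),
              run_cons_of_forall (fun | t i => t i | s l => if l = m then s l else s (l - 1))]
            · simp [h1, ih m n (by omega)]
            all_goals simp [act]; grind
          · cases ho : act x (s m) <;> simp [run, act, *, Ne.symm]
          · cases ho : act x (s m) <;> simp [run, act, *, Ne.symm]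
          · rw [run_cons_of_forall id, run_cons_of_forall id]
            · simp [ih m (n + 1) (by omega)]
            all_goals simp [act]; grind
    · rcases m with _ | m
      · obtain ⟨n, rfl⟩ : ∃ n', n = n' + 1 := ⟨n - 1, by omega⟩
        rw [run_cons_of_forall (fun | t i => t i | s 0 => t i | s (m + 1) => s m),
          run_cons_of_forall (fun | t i => t i | s 0 => t i | s (m + 1) => s m)]
        · simp [run_comm_st x n i]
        all_goals simp [act]
      · rw [run_cons_of_forall (fun | t i => t i | s m => s (m - 1)),
          run_cons_of_forall (fun | t i => t i | s m => s (m - 1))]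
        · simp [ih m n (by omega)]
        all_goals simp [act]
    · rcases lt_trichotomy k m with hk | rfl | hk
      · obtain ⟨m, rfl⟩ : ∃ m', m = m' + 1 := ⟨m - 1, by omega⟩
        rw [run_cons_of_forall (fun | t i => t i | s m => s (m - 1)),
          run_cons_of_forall (fun | t i => t i | s m => s (m - 1))]
        · simp [ih m n (by omega)]
        all_goals simp [act]; grind
      · cases ho : act x (s n) <;> simp [run, act, *, Ne.symm]
      · rcases (show k = m + 1 ∨ m + 1 < k by omega) with rfl | h
        · cases ho : act x (s n) <;> simp [run, act, *, Ne.symm]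
        · rcases (show k < n + 1 ∨ k = n + 1 ∨ k = n + 2 ∨ n + 2 < k by omega) with hk | rfl | rfl | hk
          · rw [run_cons_of_forall (fun | t i => t i | s l => if l = m then s l else s (l - 1)),
              run_cons_of_forall (fun | t i => t i | s l => if l = m then s l else s (l - 1))]
            · simp [h1, ih m n (by omega)]
            all_goals simp [act]; grind
          · cases ho : act x (s m) <;> simp [run, act, *, Ne.symm]
          · cases ho : act x (s m) <;> simp [run, act, *, Ne.symm]
          · rw [run_cons_of_forall id, run_cons_of_forall id]
            · simp [ih m (n + 1) (by omega)]
            all_goals simp [act]; grind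

theorem run_circle (x : List (Pos e)) : ∀ i j,
    run x [t i, t (i - 1)] = run x [t j, t (j - 1)] := by
  induction x with
  | nil => simp
  | cons q x ih =>
    intro i j
    rcases q with (_ | k) | k | (_ | k)
    · simp [run, act]
    · rw [run_cons_of_forall id, run_cons_of_forall id]
      · simp [ih i j]
      all_goals simp [act]
    · by_cases hi : i = k - 1 <;> by_cases hj : j = k - 1 <;> simp [run, act, hi, hj]
    · simp [run, act]
    · rw [run_cons_of_forall (fun | t i => t (i + 1) | s m => s m),
          run_cons_of_forall (fun | t i => t (i + 1) | s m => s m)]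
      · simpa using congrArg (Option.map (right (k + 1) :: ·)) (ih (i + 1) (j + 1))
      all_goals simp [act]
end Action

/-! ### Braids represented by lists of positions -/

section Evaluation

variable {e r : ℕ}

open Letter Pos

variable (e r) in
/-- The generator `t_i` as an element of the monoid. -/
def T (i : ZMod e) : BraidMonoid e r := atom (.t i)

variable (e r) in
/-- The generator `s_{n+3}` as an element of the monoid, and `1` if it is out of range. -/
def S (n : ℕ) : BraidMonoid e r :=
  -- With the default value 1 the commutation rules hold without bounds on the indices; the braid
  -- rules do need them.
  if h : n + 3 ≤ r then atom (.s (n + 3) (by omega) h) else 1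

variable (e r) in
/-- The common value of the products `t_i t_{i-1}`. -/
def circ : BraidMonoid e r := T e r 1 * T e r 0

local notation "τ" => T e r
local notation "σ" => S e r
local notation "γ" => circ e r

theorem T_mul_T (i : ZMod e) : τ i * τ (i - 1) = γ := by
  simpa [circ, T] using circle_eq (r := r) i 1

theorem T_succ_mul_T (i : ZMod e) : τ (i + 1) * τ i = γ := by
  rw [← T_mul_T (i + 1), add_sub_cancel_right]

theorem S_comm {m n : ℕ} (h : m + 1 < n) : σ m * σ n = σ n * σ m := by
  unfold S
  split_ifs with h1 h2
  · exact Comm.eq (Or.inl (by omega))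
  all_goals simp

theorem S_T_comm {m : ℕ} (h : 1 ≤ m) (i : ZMod e) : σ m * τ i = τ i * σ m := by
  unfold S T
  split_ifs with h1
  · exact Comm.eq (show 4 ≤ m + 3 by omega)
  · simp

theorem S_braid {n : ℕ} (h : n + 4 ≤ r) : σ n * σ (n + 1) * σ n = σ (n + 1) * σ n * σ (n + 1) := by
  rw [S, S, dif_pos (by omega), dif_pos (by omega)]
  exact Braided.eq (Or.inl rfl)

theorem S_T_braid (h : 3 ≤ r) (i : ZMod e) : σ 0 * τ i * σ 0 = τ i * σ 0 * τ i := by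
  rw [S, dif_pos (by omega)]
  exact Braided.eq (show 0 + 3 = 3 from rfl)

theorem circ_comm {m : ℕ} (h : 1 ≤ m) : γ * σ m = σ m * γ := by
  rw [circ, mul_assoc, ← S_T_comm h, ← mul_assoc, ← S_T_comm h, mul_assoc]

variable (e r) in
/-- The descending product `σ (K - 1) * ⋯ * σ n`. -/
def dn : ℕ → ℕ → BraidMonoid e r
  | 0, _ => 1
  | K + 1, n => if n ≤ K then σ K * dn K n else 1

variable (e r) in
/-- The ascending product `σ 0 * ⋯ * σ (n - 1)`. -/
def up : ℕ → BraidMonoid e r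
  | 0 => 1
  | n + 1 => up n * σ n

local notation "δ" => dn e r
local notation "υ" => up e r

theorem dn_of_le {K n : ℕ} (h : K ≤ n) : δ K n = 1 := by
  cases K with
  | zero => rfl
  | succ K => rw [dn, if_neg (by omega)]

theorem dn_succ {K n : ℕ} (h : n ≤ K) : δ (K + 1) n = σ K * δ K n := by
  rw [dn, if_pos h]

theorem dn_eq {K n : ℕ} (h : n < K) : δ K n = δ K (n + 1) * σ n := by
  induction K with
  | zero => omega
  | succ K ih =>
    rcases Nat.lt_succ_iff_lt_or_eq.1 h with h | rfl
    · rw [dn_succ (by omega), dn_succ (by omega), ih h, mul_assoc]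
    · rw [dn_succ le_rfl, dn_of_le le_rfl, dn_of_le le_rfl, mul_one, one_mul]

theorem dn_mul_dn {K n : ℕ} (h : n ≤ K) : δ K n * δ n 0 = δ K 0 := by
  induction K, h using Nat.le_induction with
  | base => rw [dn_of_le le_rfl, one_mul]
  | succ K h ih => rw [dn_succ h, dn_succ (Nat.zero_le _), mul_assoc, ih]

theorem dn_comm {K n m : ℕ} (h : m + 1 < n ∨ K < m) : δ K n * σ m = σ m * δ K n := by
  induction K with
  | zero => simp [dn]
  | succ K ih =>
    by_cases hn : n ≤ K
    · rw [dn_succ hn, mul_assoc, ih (by omega), ← mul_assoc, ← mul_assoc]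
      congr 1
      rcases h with h | h
      · exact (S_comm (by omega)).symm
      · exact S_comm (by omega)
    · rw [dn_of_le (by omega), mul_one, one_mul]

theorem dn_comm_T {K n : ℕ} (h : 1 ≤ n) (i : ZMod e) : δ K n * τ i = τ i * δ K n := by
  induction K with
  | zero => simp [dn]
  | succ K ih =>
    by_cases hn : n ≤ K
    · rw [dn_succ hn, mul_assoc, ih, ← mul_assoc, ← mul_assoc, S_T_comm (by omega)]
    · rw [dn_of_le (by omega), mul_one, one_mul]

/-- One braid relation acts where the descending product contains both `σ (m + 1)` and `σ m`; the
remaining letters commute with the one that passes. -/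
theorem dn_shift {K n m : ℕ} (hr : K + 2 ≤ r) (h1 : n ≤ m) (h2 : m + 1 < K) :
    δ K n * σ (m + 1) = σ m * δ K n := by
  induction K with
  | zero => omega
  | succ K ih =>
    rw [dn_succ (by omega), mul_assoc]
    rcases Nat.lt_succ_iff_lt_or_eq.1 h2 with h2 | h2
    · rw [ih (by omega) h2, ← mul_assoc, ← mul_assoc, S_comm h2]
    · subst h2
      rw [dn_succ h1, mul_assoc, dn_comm (Or.inr (Nat.lt_succ_self _)), ← mul_assoc, ← mul_assoc,
        ← S_braid (by omega)]
      simp only [mul_assoc]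

theorem up_comm {n m : ℕ} (h : n < m) : υ n * σ m = σ m * υ n := by
  induction n with
  | zero => simp [up]
  | succ n ih =>
    rw [up, mul_assoc, S_comm h, ← mul_assoc, ih (by omega), mul_assoc]

theorem up_shift {n m : ℕ} (hr : n + 2 ≤ r) (h : m + 1 < n) : υ n * σ m = σ (m + 1) * υ n := by
  induction n with
  | zero => omega
  | succ n ih =>
    rcases Nat.lt_succ_iff_lt_or_eq.1 h with h | h
    · rw [up, mul_assoc, ← S_comm h, ← mul_assoc, ih (by omega) h, mul_assoc]
    · subst h
      rw [up, up, mul_assoc, mul_assoc, ← mul_assoc (σ m), S_braid (by omega), ← mul_assoc,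
        ← mul_assoc, up_comm (Nat.lt_succ_self _)]
      simp only [mul_assoc]

variable (e r) in
/-- The contribution of the wire `K + 2` to a simple braid. -/
def evPos (K : ℕ) : Pos e → BraidMonoid e r
  | left n => δ K n
  | corner i => δ K 0 * τ i
  | right n => δ K 0 * (γ * υ n)

variable (r) in
/-- The element represented by a list of positions. -/
def ev : List (Pos e) → BraidMonoid e r
  | [] => 1
  | q :: x => ev x * evPos e r x.length q

variable (e r) in
/-- The element represented by a letter. -/
def val : Letter e → BraidMonoid e r
  | .t i => τ i
  | .s n => σ n

/-- The positions that the wire `K + 2` can reach. -/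
def ValidPos (K : ℕ) : Pos e → Prop
  | left n => n ≤ K
  | corner _ => True
  | right n => n ≤ K

/-- The lists of positions that represent simple braids. -/
def Valid : List (Pos e) → Prop
  | [] => True
  | q :: x => ValidPos x.length q ∧ Valid x

/-- The letters that move only the first `K + 1` wires. -/
def InRange (K : ℕ) : Letter e → Prop
  | .t _ => 1 ≤ K
  | .s n => n + 1 < K

theorem evPos_left_mul_S {K m n : ℕ} (hr : K + 2 ≤ r) (hm : m < K) (h : n < m) :
    evPos e r K (left n) * σ m = σ (m - 1) * evPos e r K (left n) := by
  obtain ⟨m, rfl⟩ : ∃ m', m = m' + 1 := ⟨m - 1, by omega⟩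
  exact dn_shift hr (by omega) hm

/-- The relation `s_3 t_i s_3 = t_i s_3 t_i` at the right end produces a `τ i` in front, which
commutes with the rest of the descent. -/
theorem evPos_corner_mul_S_zero {K : ℕ} (hr : K + 2 ≤ r) (hK : 1 ≤ K) (i : ZMod e) :
    evPos e r K (corner i) * σ 0 = τ i * evPos e r K (corner i) := by
  simp only [evPos]
  rw [dn_eq (by omega : 0 < K), mul_assoc, mul_assoc, ← mul_assoc (σ 0), S_T_braid (by omega),
    ← mul_assoc, ← mul_assoc, dn_comm_T (by omega)]
  simp only [mul_assoc]

theorem evPos_corner_mul_S {K m : ℕ} (hr : K + 2 ≤ r) (hm : m < K) (h : m ≠ 0) (i : ZMod e) :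
    evPos e r K (corner i) * σ m = σ (m - 1) * evPos e r K (corner i) := by
  simp only [evPos]
  rw [mul_assoc, ← S_T_comm (by omega), ← mul_assoc]
  have := evPos_left_mul_S (e := e) (n := 0) hr hm (by omega)
  rw [evPos] at this
  rw [this, mul_assoc]

theorem evPos_right_mul_S_lt {K m n : ℕ} (hr : K + 2 ≤ r) (hn : n ≤ K) (h : m + 1 < n) :
    evPos e r K (right n) * σ m = σ m * evPos e r K (right n) := by
  simp only [evPos]
  rw [mul_assoc, mul_assoc, up_shift (by omega) h, ← mul_assoc γ, circ_comm (by omega),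
    mul_assoc, ← mul_assoc, dn_shift hr (by omega) (by omega), mul_assoc]

theorem evPos_right_mul_S_gt {K m n : ℕ} (hr : K + 2 ≤ r) (hm : m < K) (h : n < m) :
    evPos e r K (right n) * σ m = σ (m - 1) * evPos e r K (right n) := by
  simp only [evPos]
  rw [mul_assoc, mul_assoc, up_comm h, ← mul_assoc γ, circ_comm (by omega), mul_assoc, ← mul_assoc]
  have := evPos_left_mul_S (e := e) (n := 0) hr hm (by omega)
  rw [evPos] at this
  rw [this, mul_assoc]

/-- Two mixed braid relations around the factorisation `γ = t_{j+1} t_j`. This is the origin of the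
index shift under conjugation by a turn, and so by `delta`. -/
theorem S_circ_S_T (hr : 3 ≤ r) (j : ZMod e) :
    σ 0 * (γ * (σ 0 * τ j)) = τ (j + 1) * (σ 0 * (γ * σ 0)) := by
  have h1 := S_T_braid hr (j + 1)
  have h2 := S_T_braid hr j
  calc σ 0 * (γ * (σ 0 * τ j)) = σ 0 * τ (j + 1) * (τ j * σ 0 * τ j) := by
        rw [← T_succ_mul_T j]; simp only [mul_assoc]
    _ = (σ 0 * τ (j + 1) * σ 0) * τ j * σ 0 := by rw [← h2]; simp only [mul_assoc]
    _ = τ (j + 1) * (σ 0 * (γ * σ 0)) := by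
        rw [h1, ← T_succ_mul_T j]; simp only [mul_assoc]

theorem up_succ_eq (n : ℕ) : ∃ w, υ (n + 1) = σ 0 * w ∧ ∀ j, w * τ j = τ j * w := by
  induction n with
  | zero => exact ⟨1, by simp [up], by simp⟩
  | succ n ih =>
    obtain ⟨w, h1, h2⟩ := ih
    refine ⟨w * σ (n + 1), by rw [up, h1, mul_assoc], fun j => ?_⟩
    rw [mul_assoc, S_T_comm (by omega), ← mul_assoc, h2, mul_assoc]

theorem evPos_right_mul_T {K n : ℕ} (hr : K + 2 ≤ r) (hn : n ≤ K) (h : n ≠ 0) (j : ZMod e) :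
    evPos e r K (right n) * τ j = τ (j + 1) * evPos e r K (right n) := by
  obtain ⟨n, rfl⟩ : ∃ m, n = m + 1 := ⟨n - 1, by omega⟩
  obtain ⟨w, h1, h2⟩ := up_succ_eq (r := r) (e := e) n
  simp only [evPos]
  calc δ K 0 * (γ * υ (n + 1)) * τ j = δ K 1 * (σ 0 * (γ * (σ 0 * τ j))) * w := by
        rw [h1, dn_eq (by omega : 0 < K)]
        simp only [mul_assoc, h2]
    _ = δ K 1 * τ (j + 1) * (σ 0 * (γ * σ 0)) * w := by
        rw [S_circ_S_T (by omega)]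
        simp only [mul_assoc]
    _ = τ (j + 1) * (δ K 0 * (γ * υ (n + 1))) := by
        rw [dn_comm_T le_rfl, h1, dn_eq (by omega : 0 < K)]
        simp only [mul_assoc]

theorem length_of_act {x : List (Pos e)} : ∀ {y a}, act x a = some y → y.length = x.length := by
  induction x with
  | nil => simp [act]
  | cons q x ih =>
    intro y a h
    rcases q with n | i | n <;> rcases a with j | m <;> 
      simp only [act] at h <;> grind [Option.map_eq_some_iff]

/-- A successful action of a letter is a right multiplication. -/
theorem ev_mul_val {x : List (Pos e)} : ∀ {y a}, x.length + 1 ≤ r → Valid x →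
    InRange x.length a → act x a = some y → Valid y ∧ ev r x * val e r a = ev r y := by
  induction x with
  | nil => simp [act]
  | cons q x ih =>
    intro y a hr hx ha h
    -- There are two kinds of success: the letter crosses the last wire and acts as `b` on the
    -- others (`key`), or it moves the last wire itself (`key'`).
    have key : ∀ b z, act x b = some z → InRange x.length b →
        evPos e r x.length q * val e r a = val e r b * evPos e r x.length q →
        Valid (q :: z) ∧ ev r (q :: x) * val e r a = ev r (q :: z) := by
      intro b z hz hb hq
      obtain ⟨h1, h2⟩ := ih (by simp at hr; omega) hx.2 hb hz
      have hl := length_of_act hz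
      exact ⟨⟨hl ▸ hx.1, h1⟩, by rw [ev, mul_assoc, hq, ← mul_assoc, h2, ev, hl]⟩
    have key' : ∀ q', ValidPos x.length q' →
        evPos e r x.length q * val e r a = evPos e r x.length q' →
        Valid (q' :: x) ∧ ev r (q :: x) * val e r a = ev r (q' :: x) := by
      intro q' hq' hq
      exact ⟨⟨hq', hx.2⟩, by rw [ev, mul_assoc, hq, ev]⟩
    have hK : x.length + 2 ≤ r := by simp at hr; omega
    have hq := hx.1
    have ha' : InRange (x.length + 1) a := ha
    rcases q with n | i | n <;> rcases a with j | m <;> simp only [act] at h <;>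
      simp only [InRange, ValidPos] at ha' hq
    · split_ifs at h with hn
      · obtain rfl := Option.some.inj h
        subst hn
        exact key' _ trivial rfl
      · obtain ⟨z, hz, rfl⟩ := Option.map_eq_some_iff.1 h
        exact key _ _ hz (by simp only [InRange]; omega) (dn_comm_T (by omega) j)
    · split_ifs at h with h1 h2 h3
      · obtain rfl := Option.some.inj h
        subst h1
        exact key' _ (by simp only [ValidPos]; omega) (dn_eq (by omega)).symm
      · obtain ⟨z, hz, rfl⟩ := Option.map_eq_some_iff.1 h
        exact key _ _ hz (by simp only [InRange]; omega) (dn_comm (Or.inl (by omega)))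
      · obtain ⟨z, hz, rfl⟩ := Option.map_eq_some_iff.1 h
        exact key _ _ hz (by simp only [InRange]; omega)
          (evPos_left_mul_S hK (by omega) (by omega))
    · split_ifs at h with hj
      obtain rfl := Option.some.inj h
      refine key' _ (Nat.zero_le _) ?_
      subst hj
      simp only [evPos, val, up, mul_assoc, mul_one, T_mul_T]
    · split_ifs at h with hm
      · subst hm
        obtain ⟨z, hz, rfl⟩ := Option.map_eq_some_iff.1 h
        exact key _ _ hz (by simp only [InRange]; omega)
          (evPos_corner_mul_S_zero hK (by omega) i)
      · obtain ⟨z, hz, rfl⟩ := Option.map_eq_some_iff.1 h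
        exact key _ _ hz (by simp only [InRange]; omega)
          (evPos_corner_mul_S hK (by omega) hm i)
    · split_ifs at h with hn
      obtain ⟨z, hz, rfl⟩ := Option.map_eq_some_iff.1 h
      exact key _ _ hz (by simp only [InRange]; omega) (evPos_right_mul_T hK hq hn j)
    · split_ifs at h with h1 h2 h3
      · obtain rfl := Option.some.inj h
        subst h1
        exact key' _ (by simp only [ValidPos]; omega)
          (by simp only [evPos, val, up, mul_assoc])
      · obtain ⟨z, hz, rfl⟩ := Option.map_eq_some_iff.1 h
        exact key _ _ hz (by simp only [InRange]; omega)
          (evPos_right_mul_S_lt hK hq (by omega))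
      · obtain ⟨z, hz, rfl⟩ := Option.map_eq_some_iff.1 h
        exact key _ _ hz (by simp only [InRange]; omega)
          (evPos_right_mul_S_gt hK (by omega) (by omega))

/-- The letter of a generator. -/
def letter : Gen e r → Letter e
  | .t i => t i
  | .s j _ _ => s (j - 3)

theorem val_letter (a : Gen e r) : val e r (letter a) = atom a := by
  rcases a with i | ⟨j, h3, hr⟩
  · rfl
  · obtain ⟨j, rfl⟩ : ∃ m, j = m + 3 := ⟨j - 3, by omega⟩
    simp only [letter, val, S, Nat.add_sub_cancel, dif_pos hr]

theorem inRange_letter {K : ℕ} (hr : r = K + 1) (hK : 1 ≤ K) (a : Gen e r) :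
    InRange K (letter a) := by
  rcases a with i | ⟨j, h3, hr⟩
  · exact hK
  · simp only [letter, InRange]; omega

/-- The partial right action of the braid monoid on lists of positions. -/
def actHom (e r : ℕ) [Nontrivial (ZMod e)] :
    BraidMonoid e r →* (Function.End (Option (List (Pos e))))ᵐᵒᵖ :=
  PresentedMonoid.lift (fun a => .op fun o => o.bind (act · (letter a))) (by
    have h2 : ∀ a b : Gen e r, ∀ x, run x [letter a, letter b] =
        ((some x).bind (act · (letter a))).bind (act · (letter b)) := by
      intro a b x; simp [run]
    have h3 : ∀ a b c : Gen e r, ∀ x, run x [letter a, letter b, letter c] =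
        (((some x).bind (act · (letter a))).bind (act · (letter b))).bind
          (act · (letter c)) := by
      intro a b c x; simp [run, Option.bind_assoc]
    intro u v h
    apply MulOpposite.unop_injective
    funext o
    rcases o with _ | x
    · cases h <;> rfl
    · cases h with
      | braid_ss i j hi hi' hj hj' h =>
        refine (h3 _ _ _ x).symm.trans (Eq.trans ?_ (h3 _ _ _ x))
        simp only [letter]
        rcases h with rfl | rfl
        · rw [show i + 1 - 3 = i - 3 + 1 by omega]
          exact run_braid_ss x _
        · rw [show j + 1 - 3 = j - 3 + 1 by omega]
          exact (run_braid_ss x _).symm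
      | comm_ss i j hi hi' hj hj' h =>
        refine (h2 _ _ x).symm.trans (Eq.trans ?_ (h2 _ _ x))
        rcases h with h | h
        · exact run_comm_ss x _ _ (by omega)
        · exact (run_comm_ss x _ _ (by omega)).symm
      | braid_st i h =>
        refine (h3 _ _ _ x).symm.trans (Eq.trans ?_ (h3 _ _ _ x))
        exact run_braid_st x i
      | comm_st i j hj hr h4 =>
        refine (h2 _ _ x).symm.trans (Eq.trans ?_ (h2 _ _ x))
        simp only [letter]
        rw [show j - 3 = j - 4 + 1 by omega]
        exact run_comm_st x _ i
      | circle i j =>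
        refine (h2 _ _ x).symm.trans (Eq.trans ?_ (h2 _ _ x))
        exact run_circle x i j)

/-- The partial right action of a braid on a list of positions. -/
def actBraid [Nontrivial (ZMod e)] (o : Option (List (Pos e))) (b : BraidMonoid e r) :
    Option (List (Pos e)) :=
  (actHom e r b).unop o

end Evaluation

/-! ### The divisors of `delta` and their number -/

section Counting

variable {e r : ℕ}

open Letter Pos

local notation "τ" => T e r
local notation "σ" => S e r
local notation "γ" => circ e r
local notation "δ" => dn e r
local notation "υ" => up e r

variable (e r) in
/-- The submonoid generated by the letters that move only the first `K + 1` wires. -/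
def parabolic (K : ℕ) : Submonoid (BraidMonoid e r) :=
  Submonoid.closure (val e r '' {a | InRange K a})

theorem val_mem_parabolic {K : ℕ} {a : Letter e} (h : InRange K a) :
    val e r a ∈ parabolic e r K :=
  Submonoid.subset_closure ⟨a, h, rfl⟩

theorem T_mem_parabolic {K : ℕ} (h : 1 ≤ K) (i : ZMod e) : τ i ∈ parabolic e r K :=
  val_mem_parabolic (a := t i) h

theorem S_mem_parabolic {K n : ℕ} (h : n + 1 < K) : σ n ∈ parabolic e r K :=
  val_mem_parabolic (a := s n) h

theorem parabolic_mono {K L : ℕ} (h : K ≤ L) : parabolic e r K ≤ parabolic e r L := by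
  refine Submonoid.closure_mono (Set.image_mono ?_)
  rintro (i | n) ha
  · exact Nat.le_trans ha h
  · exact Nat.lt_of_lt_of_le ha h

theorem circ_mem_parabolic {K : ℕ} (h : 1 ≤ K) : γ ∈ parabolic e r K :=
  mul_mem (T_mem_parabolic h _) (T_mem_parabolic h _)

theorem dn_mem_parabolic {K L : ℕ} (h : K + 1 ≤ L) (n : ℕ) : δ K n ∈ parabolic e r L := by
  induction K with
  | zero => exact one_mem _
  | succ K ih =>
    rw [dn]
    split_ifs
    · exact mul_mem (S_mem_parabolic (by omega)) (ih (by omega))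
    · exact one_mem _

theorem up_mem_parabolic {n L : ℕ} (h : n + 1 ≤ L) : υ n ∈ parabolic e r L := by
  induction n with
  | zero => exact one_mem _
  | succ n ih => exact mul_mem (ih (by omega)) (S_mem_parabolic (by omega))

theorem evPos_mem_parabolic {K : ℕ} {q : Pos e} (h : ValidPos K q) :
    evPos e r K q ∈ parabolic e r (K + 1) := by
  rcases q with n | i | n
  · exact dn_mem_parabolic le_rfl _
  · exact mul_mem (dn_mem_parabolic le_rfl _) (T_mem_parabolic (by omega) _)
  · exact mul_mem (dn_mem_parabolic le_rfl _) (mul_mem (circ_mem_parabolic (by omega))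
      (up_mem_parabolic (Nat.succ_le_succ h)))

theorem ev_mem_parabolic {x : List (Pos e)} (h : Valid x) : ev r x ∈ parabolic e r x.length := by
  induction x with
  | nil => exact one_mem _
  | cons q x ih =>
    exact mul_mem (parabolic_mono (Nat.le_succ _) (ih h.2)) (evPos_mem_parabolic h.1)

variable (e r) in
/-- The pure braid in which the wire `K + 2` turns around the wires on its left. -/
def turn (K : ℕ) : BraidMonoid e r := δ K 0 * (γ * υ K)

variable (e r) in
/-- The Garside element of the first `K + 1` wires. -/
def delta : ℕ → BraidMonoid e r
  | 0 => 1
  | K + 1 => delta K * turn e r K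

variable (e) in
/-- The list of positions of the trivial braid. -/
def initial : ℕ → List (Pos e)
  | 0 => []
  | K + 1 => left K :: initial K

variable (e) in
/-- The list of positions of the Garside element. -/
def final : ℕ → List (Pos e)
  | 0 => []
  | K + 1 => right K :: final K

@[simp] theorem length_initial (K : ℕ) : (initial e K).length = K := by
  induction K with
  | zero => rfl
  | succ K ih => simp [initial, ih]

@[simp] theorem length_final (K : ℕ) : (final e K).length = K := by
  induction K with
  | zero => rfl
  | succ K ih => simp [final, ih]

theorem valid_initial (K : ℕ) : Valid (initial e K) := by
  induction K with
  | zero => trivial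
  | succ K ih => exact ⟨(length_initial (e := e) K).ge, ih⟩

theorem valid_final (K : ℕ) : Valid (final e K) := by
  induction K with
  | zero => trivial
  | succ K ih => exact ⟨(length_final (e := e) K).ge, ih⟩

theorem ev_initial (K : ℕ) : ev r (initial e K) = 1 := by
  induction K with
  | zero => rfl
  | succ K ih => simp [initial, ev, ih, evPos, dn_of_le]

theorem ev_final (K : ℕ) : ev r (final e K) = delta e r K := by
  induction K with
  | zero => rfl
  | succ K ih => simp [final, ev, ih, evPos, delta, turn]

theorem val_mul_turn {K : ℕ} (hr : K + 2 ≤ r) {a : Letter e} (ha : InRange K a) :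
    ∃ b, InRange K b ∧ val e r a * turn e r K = turn e r K * val e r b := by
  rcases a with i | n
  · refine ⟨t (i - 1), ha, ?_⟩
    have := evPos_right_mul_T (e := e) hr le_rfl (show K ≠ 0 by simp [InRange] at ha; omega) (i - 1)
    rw [sub_add_cancel] at this
    exact this.symm
  · exact ⟨s n, ha, (evPos_right_mul_S_lt hr le_rfl ha).symm⟩

/-- A letter to the left of the turning wire passes the turn and stays in the same parabolic
submonoid. This moves a complement past a turn in `ev_dvd`. -/
theorem mul_turn_of_mem {K : ℕ} (hr : K + 2 ≤ r) {y : BraidMonoid e r}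
    (hy : y ∈ parabolic e r K) : ∃ y' ∈ parabolic e r K, y * turn e r K = turn e r K * y' := by
  induction hy using Submonoid.closure_induction with
  | mem y h =>
    obtain ⟨a, ha, rfl⟩ := h
    obtain ⟨b, hb, h⟩ := val_mul_turn hr ha
    exact ⟨_, val_mem_parabolic hb, h⟩
  | one => exact ⟨1, one_mem _, by simp⟩
  | mul y z _ _ hy hz =>
    obtain ⟨y', hy', h1⟩ := hy
    obtain ⟨z', hz', h2⟩ := hz
    exact ⟨y' * z', mul_mem hy' hz', by rw [mul_assoc, h2, ← mul_assoc, h1, mul_assoc]⟩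

theorem up_dvd {K n : ℕ} (h : n ≤ K) : ∃ y ∈ parabolic e r (K + 1), υ n * y = υ K := by
  induction K, h using Nat.le_induction with
  | base => exact ⟨1, one_mem _, mul_one _⟩
  | succ K h ih =>
    obtain ⟨y, hy, h1⟩ := ih
    exact ⟨y * σ K, mul_mem (parabolic_mono (Nat.le_succ _) hy) (S_mem_parabolic (by omega)),
      by rw [← mul_assoc, h1, up]⟩

/-- The complement is the rest of the path of a full turn. Every corner lies on such a path, because
`γ = t_i t_{i-1}` for all `i`. -/
theorem evPos_dvd {K : ℕ} {q : Pos e} (h : ValidPos K q) :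
    ∃ y ∈ parabolic e r (K + 1), evPos e r K q * y = turn e r K := by
  rcases q with n | i | n
  · refine ⟨δ n 0 * (γ * υ K), mul_mem (dn_mem_parabolic (Nat.succ_le_succ h) _)
      (mul_mem (circ_mem_parabolic (by omega)) (up_mem_parabolic le_rfl)), ?_⟩
    rw [evPos, ← mul_assoc, dn_mul_dn h, turn]
  · refine ⟨τ (i - 1) * υ K, mul_mem (T_mem_parabolic (by omega) _) (up_mem_parabolic le_rfl), ?_⟩
    rw [evPos, turn, ← T_mul_T i]
    simp only [mul_assoc]
  · obtain ⟨y, hy, h1⟩ := up_dvd (e := e) (r := r) h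
    exact ⟨y, hy, by rw [evPos, turn, ← h1]; simp only [mul_assoc]⟩

/-- The lists of positions represent divisors of the Garside element. -/
theorem ev_dvd {x : List (Pos e)} (hr : x.length + 1 ≤ r) (h : Valid x) :
    ∃ y ∈ parabolic e r x.length, ev r x * y = delta e r x.length := by
  induction x with
  | nil => exact ⟨1, one_mem _, by simp [ev, delta]⟩
  | cons q x ih =>
    simp only [List.length_cons] at *
    obtain ⟨y, hy, h1⟩ := ih (by omega) h.2
    obtain ⟨z, hz, h2⟩ := evPos_dvd (r := r) h.1
    obtain ⟨y', hy', h3⟩ := mul_turn_of_mem (by omega) hy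
    refine ⟨z * y', mul_mem hz (parabolic_mono (Nat.le_succ _) hy'), ?_⟩
    rw [ev, mul_assoc, ← mul_assoc _ z, h2, ← h3, ← mul_assoc, h1, delta]

section Act

variable [Nontrivial (ZMod e)]

theorem actBraid_one (o : Option (List (Pos e))) : actBraid o (1 : BraidMonoid e r) = o := by
  simp only [actBraid, map_one]; rfl

theorem actBraid_mul (o : Option (List (Pos e))) (x y : BraidMonoid e r) :
    actBraid o (x * y) = actBraid (actBraid o x) y := by
  simp only [actBraid, map_mul]; rfl

theorem actBraid_atom (o : Option (List (Pos e))) (a : Gen e r) :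
    actBraid o (atom a) = o.bind (act · (letter a)) := rfl

theorem actBraid_T (o : Option (List (Pos e))) (i : ZMod e) :
    actBraid o (τ i) = o.bind (act · (t i)) := rfl

theorem actBraid_S (o : Option (List (Pos e))) {n : ℕ} (h : n + 3 ≤ r) :
    actBraid o (σ n) = o.bind (act · (s n)) := by
  rw [S, dif_pos h]; rfl

theorem actBraid_none (b : BraidMonoid e r) : actBraid none b = none := by
  induction b using atom_induction with
  | one => exact actBraid_one _
  | mul a x ih => rw [actBraid_mul, actBraid_atom, Option.bind_none, ih]

/-- A last wire still in its starting place is not touched by letters on its left, so `actBraid_ev`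
can treat the wires one by one. -/
theorem actBraid_cons_left {K : ℕ} (hr : K + 1 ≤ r) {y : BraidMonoid e r}
    (hy : y ∈ parabolic e r K) (o : Option (List (Pos e))) :
    actBraid (o.map (left K :: ·)) y = (actBraid o y).map (left K :: ·) := by
  induction hy using Submonoid.closure_induction generalizing o with
  | mem y h =>
    obtain ⟨a, ha, rfl⟩ := h
    rcases a with i | n
    · have hK : K ≠ 0 := by simp [InRange] at ha; omega
      cases o <;> simp [val, actBraid_T, act, hK]
    · have h1 : n + 1 < K := ha
      have h2 : n < K := by omega
      rw [val, actBraid_S _ (by omega), actBraid_S _ (by omega)]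
      cases o <;> simp [act, h1.ne, h2.ne, h2]
  | one => simp [actBraid_one]
  | mul y z _ _ hy hz => rw [actBraid_mul, actBraid_mul, hy, hz]

theorem actBraid_dn {K n : ℕ} (hr : K + 2 ≤ r) (h : n ≤ K) (x : List (Pos e)) :
    actBraid (some (left K :: x)) (δ K n) = some (left n :: x) := by
  induction h using Nat.decreasingInduction with
  | self => rw [dn_of_le le_rfl, actBraid_one]
  | of_succ n h ih =>
    rw [dn_eq (by omega), actBraid_mul, ih, actBraid_S _ (by omega)]
    simp [act]

theorem actBraid_up {n : ℕ} (hr : n + 2 ≤ r) (x : List (Pos e)) :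
    actBraid (some (right 0 :: x)) (υ n) = some (right n :: x) := by
  induction n with
  | zero => exact actBraid_one _
  | succ n ih =>
    rw [up, actBraid_mul, ih (by omega), actBraid_S _ (by omega)]
    simp [act]

theorem actBraid_evPos {K : ℕ} (hr : K + 2 ≤ r) {q : Pos e} (h : ValidPos K q)
    (x : List (Pos e)) : actBraid (some (left K :: x)) (evPos e r K q) = some (q :: x) := by
  rcases q with n | i | n
  · exact actBraid_dn hr h x
  · rw [evPos, actBraid_mul, actBraid_dn hr (Nat.zero_le _), actBraid_T]
    simp [act]
  · rw [evPos, actBraid_mul, actBraid_mul, actBraid_dn hr (Nat.zero_le _), circ, actBraid_mul,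
      actBraid_T, actBraid_T]
    simpa [act] using actBraid_up (show n + 2 ≤ r from (Nat.add_le_add_right h 2).trans hr) x

theorem actBraid_ev {x : List (Pos e)} (hr : x.length + 1 ≤ r) (h : Valid x) :
    actBraid (some (initial e x.length)) (ev r x) = some x := by
  induction x with
  | nil => exact actBraid_one _
  | cons q x ih =>
    simp only [List.length_cons] at *
    have h1 := actBraid_cons_left (r := r) (by omega) (ev_mem_parabolic h.2)
      (some (initial e x.length))
    rw [ih (by omega) h.2] at h1
    rw [ev, actBraid_mul, initial, ← Option.map_some (f := (left x.length :: ·)), h1]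
    exact actBraid_evPos (by omega) h.1 x

theorem ev_mul_of_actBraid {K : ℕ} (hr : r = K + 1) (hK : 1 ≤ K) {b : BraidMonoid e r} :
    ∀ {x y : List (Pos e)}, x.length = K → Valid x → actBraid (some x) b = some y →
      y.length = K ∧ Valid y ∧ ev r x * b = ev r y := by
  induction b using atom_induction with
  | one =>
    intro x y hl hx h
    obtain rfl := Option.some.inj ((actBraid_one _).symm.trans h)
    exact ⟨hl, hx, mul_one _⟩
  | mul a b ih =>
    intro x y hl hx h
    rw [actBraid_mul, actBraid_atom, Option.bind_some] at h
    cases hz : act x (letter a) with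
    | none => rw [hz, actBraid_none] at h; cases h
    | some z =>
      rw [hz] at h
      obtain ⟨h1, h2⟩ := ev_mul_val (r := r) (show x.length + 1 ≤ r by omega) hx
        (hl ▸ inRange_letter hr hK a) hz
      obtain ⟨h3, h4, h5⟩ := ih ((length_of_act hz).trans hl) h1 h
      exact ⟨h3, h4, by rw [← h5, ← h2, val_letter, mul_assoc]⟩

/-- Failure is absorbing, and `delta` carries `initial` to `final`. Hence a left divisor also acts
on `initial` without failure, and the list it reaches represents it. -/
theorem leftDvd_delta_iff {K : ℕ} (hr : r = K + 1) (hK : 1 ≤ K) {b : BraidMonoid e r} :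
    LeftDvd b (delta e r K) ↔ ∃ x : List (Pos e), x.length = K ∧ Valid x ∧ ev r x = b := by
  constructor
  · rintro ⟨z, hz⟩
    have h := actBraid_ev (e := e) (r := r) (x := final e K) (by simp [hr]) (valid_final K)
    rw [ev_final, length_final, ← hz, actBraid_mul] at h
    cases hb : actBraid (some (initial e K)) b with
    | none => rw [hb, actBraid_none] at h; cases h
    | some y =>
      obtain ⟨h1, h2, h3⟩ := ev_mul_of_actBraid hr hK (length_initial K) (valid_initial K) hb
      exact ⟨y, h1, h2, by rw [← h3, ev_initial, one_mul]⟩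
  · rintro ⟨x, rfl, hx, rfl⟩
    obtain ⟨y, _, hy⟩ := ev_dvd (r := r) hr.ge hx
    exact ⟨y, hy⟩

end Act

/-- The action on the trivial list recovers `x` from `ev r x`. -/
theorem ev_injOn [Nontrivial (ZMod e)] {K : ℕ} (hr : r = K + 1) :
    Set.InjOn (ev (e := e) r) {x | x.length = K ∧ Valid x} := by
  rintro x ⟨hx, hx'⟩ y ⟨hy, hy'⟩ h
  have h1 := actBraid_ev (r := r) (by omega) hx'
  have h2 := actBraid_ev (r := r) (by omega) hy'
  rw [hx] at h1
  rw [hy, ← h, h1] at h2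
  exact Option.some.inj h2

theorem sum_elim_injective : Function.Injective
    (Sum.elim (Sum.elim left corner) right : (ℕ ⊕ ZMod e) ⊕ ℕ → Pos e) := by
  rintro ((a | a) | a) ((b | b) | b) h <;> simp_all

theorem cons_injective : Function.Injective (fun p : Pos e × List (Pos e) => p.1 :: p.2) := by
  rintro ⟨a, b⟩ ⟨c, d⟩ h; simpa using h

variable (e) in
/-- The valid positions as a finite set. -/
def positions [NeZero e] (K : ℕ) : Finset (Pos e) :=
  (((Finset.range (K + 1)).disjSum (Finset.univ (α := ZMod e))).disjSum
    (Finset.range (K + 1))).image (Sum.elim (Sum.elim left corner) right)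

variable (e) in
/-- The valid lists of positions as a finite set. -/
def validLists [NeZero e] : ℕ → Finset (List (Pos e))
  | 0 => {[]}
  | K + 1 => (positions e K ×ˢ validLists K).image fun p => p.1 :: p.2

theorem mem_positions [NeZero e] {K : ℕ} {q : Pos e} : q ∈ positions e K ↔ ValidPos K q := by
  cases q <;> simp [positions, ValidPos]

theorem mem_validLists [NeZero e] {K : ℕ} {x : List (Pos e)} :
    x ∈ validLists e K ↔ x.length = K ∧ Valid x := by
  induction K generalizing x with
  | zero =>
    cases x <;> simp [validLists, Valid]
  | succ K ih =>
    cases x with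
    | nil => simp [validLists]
    | cons q x =>
      simp only [validLists, Finset.mem_image, Finset.mem_product,
        Prod.exists, List.cons.injEq, List.length_cons, Valid, Nat.add_right_cancel_iff,
        mem_positions, ih]
      constructor
      · rintro ⟨_, _, ⟨h1, rfl, h2⟩, rfl, rfl⟩
        exact ⟨rfl, h1, h2⟩
      · rintro ⟨rfl, h1, h2⟩
        exact ⟨q, x, ⟨h1, rfl, h2⟩, rfl, rfl⟩

theorem card_positions [NeZero e] (K : ℕ) : (positions e K).card = 2 * (K + 1) + e := by
  rw [positions, Finset.card_image_of_injective _ sum_elim_injective]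
  simp [ZMod.card]; omega

theorem card_validLists [NeZero e] (K : ℕ) :
    (validLists e K).card = ∏ k ∈ Finset.range K, (2 * (k + 1) + e) := by
  induction K with
  | zero => rfl
  | succ K ih =>
    rw [validLists, Finset.card_image_of_injective _ cons_injective, Finset.card_product, ih, card_positions,
      Finset.prod_range_succ, mul_comm]

theorem setOf_leftDvd_delta [NeZero e] [Nontrivial (ZMod e)] {K : ℕ} (hr : r = K + 1)
    (hK : 1 ≤ K) : {b : BraidMonoid e r | LeftDvd b (delta e r K)} = ev r '' validLists e K := by
  ext b
  simp [leftDvd_delta_iff hr hK, mem_validLists, and_assoc]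

theorem finite_leftDvd_delta [NeZero e] [Nontrivial (ZMod e)] {K : ℕ} (hr : r = K + 1)
    (hK : 1 ≤ K) : {b : BraidMonoid e r | LeftDvd b (delta e r K)}.Finite := by
  rw [setOf_leftDvd_delta hr hK]
  exact (Finset.finite_toSet _).image _

theorem ncard_leftDvd_delta [NeZero e] [Nontrivial (ZMod e)] {K : ℕ} (hr : r = K + 1)
    (hK : 1 ≤ K) : {b : BraidMonoid e r | LeftDvd b (delta e r K)}.ncard =
      ∏ k ∈ Finset.range K, (2 * (k + 1) + e) := by
  rw [setOf_leftDvd_delta hr hK, Set.InjOn.ncard_image, Set.ncard_coe_finset, card_validLists]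
  intro x hx y hy h
  exact ev_injOn hr (mem_validLists.1 hx) (mem_validLists.1 hy) h

end Counting

/-! ### `delta` is balanced and is a least common multiple of the atoms -/

section GarsideElement

variable {e r : ℕ}

open Letter Pos

local notation "τ" => T e r
local notation "σ" => S e r
local notation "γ" => circ e r
local notation "δ" => dn e r
local notation "υ" => up e r

variable (e r) in
/-- The automorphism that adds `c` to the indices of the generators `t_i`. -/
def shift (c : ZMod e) : BraidMonoid e r →* BraidMonoid e r :=
  PresentedMonoid.lift (fun | .t i => atom (.t (i + c)) | .s j h3 hr => atom (.s j h3 hr)) (by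
    intro u v h
    cases h with
    | braid_ss i j hi hi' hj hj' h =>
      exact Braided.eq (a := .s i hi hi') (b := .s j hj hj') h
    | comm_ss i j hi hi' hj hj' h => exact Comm.eq (a := .s i hi hi') (b := .s j hj hj') h
    | braid_st i h => exact Braided.eq (a := .s 3 le_rfl h) (b := .t (i + c)) rfl
    | comm_st i j h3 hr h4 => exact Comm.eq (a := .s j h3 hr) (b := .t (i + c)) h4
    | circle i j =>
      have := circle_eq (r := r) (i + c) (j + c)
      rw [add_sub_right_comm, add_sub_right_comm j] at this
      exact this)

theorem shift_T (c i : ZMod e) : shift e r c (τ i) = τ (i + c) := rfl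

theorem shift_S (c : ZMod e) (n : ℕ) : shift e r c (σ n) = σ n := by
  unfold S
  split_ifs
  · rfl
  · exact map_one _

theorem shift_shift_neg (c : ZMod e) (x : BraidMonoid e r) :
    shift e r c (shift e r (-c) x) = x := by
  induction x using atom_induction with
  | one => simp
  | mul a x ih =>
    rw [map_mul, map_mul, ih]
    congr 1
    rcases a with i | ⟨j, h3, hr⟩
    · change atom (.t (i + -c + c)) = _
      rw [neg_add_cancel_right]
    · rfl

theorem shift_circ (c : ZMod e) : shift e r c γ = γ := by
  rw [circ, map_mul, shift_T, shift_T, add_comm 1, zero_add, T_succ_mul_T, ← circ]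

theorem shift_dn (c : ZMod e) (K n : ℕ) : shift e r c (δ K n) = δ K n := by
  induction K with
  | zero => exact map_one _
  | succ K ih =>
    rw [dn]
    split_ifs
    · rw [map_mul, ih, shift_S]
    · exact map_one _

theorem shift_up (c : ZMod e) (n : ℕ) : shift e r c (υ n) = υ n := by
  induction n with
  | zero => exact map_one _
  | succ n ih => rw [up, map_mul, ih, shift_S]

theorem shift_delta (c : ZMod e) (K : ℕ) : shift e r c (delta e r K) = delta e r K := by
  induction K with
  | zero => exact map_one _
  | succ K ih => simp only [delta, turn, map_mul, ih, shift_dn, shift_up, shift_circ]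

theorem T_mul_circ (i : ZMod e) : τ i * γ = γ * τ (i - 1 - 1) := by
  rw [← T_mul_T (i - 1), ← mul_assoc, T_mul_T, T_mul_T]

theorem delta_one : delta e r 1 = γ := by simp [delta, turn, dn, up]

theorem T_mul_turn {K : ℕ} (hr : K + 2 ≤ r) (hK : 1 ≤ K) (i : ZMod e) :
    τ i * turn e r K = turn e r K * τ (i - 1) := by
  have := evPos_right_mul_T (e := e) hr le_rfl (show K ≠ 0 by omega) (i - 1)
  rw [sub_add_cancel] at this
  exact this.symm

theorem S_mul_turn {K n : ℕ} (hr : K + 2 ≤ r) (h : n + 1 < K) :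
    Commute (σ n) (turn e r K) :=
  (evPos_right_mul_S_lt hr le_rfl h).symm

/-- The factor `γ` lowers the index by 2, and each of the `K - 1` further turns lowers it by 1. -/
theorem T_mul_delta {K : ℕ} (hr : K + 1 ≤ r) (hK : 1 ≤ K) (i : ZMod e) :
    τ i * delta e r K = delta e r K * τ (i - (K + 1)) := by
  induction K, hK using Nat.le_induction generalizing i with
  | base => rw [delta_one, T_mul_circ]; congr 2; push_cast; ring
  | succ K hK ih =>
    rw [delta, ← mul_assoc, ih (by omega), mul_assoc, T_mul_turn hr hK, mul_assoc]
    congr 3; push_cast; ring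

theorem turn_mem_parabolic (K : ℕ) : turn e r K ∈ parabolic e r (K + 1) :=
  evPos_mem_parabolic (q := right K) le_rfl

theorem delta_mem_parabolic (K : ℕ) : delta e r K ∈ parabolic e r K := by
  induction K with
  | zero => exact one_mem _
  | succ K ih => exact mul_mem (parabolic_mono (Nat.le_succ _) ih) (turn_mem_parabolic K)

theorem S_commute_of_mem {K : ℕ} {w : BraidMonoid e r} (hw : w ∈ parabolic e r K) :
    Commute (σ K) w := by
  induction hw using Submonoid.closure_induction with
  | mem y h =>
    obtain ⟨i | n, ha, rfl⟩ := h
    · exact S_T_comm ha i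
    · exact (S_comm ha).symm
  | one => exact Commute.one_right _
  | mul y z _ _ hy hz => exact hy.mul_right hz

theorem turn_succ (n : ℕ) : turn e r (n + 1) = σ n * turn e r n * σ n := by
  simp only [turn, dn_succ (Nat.zero_le n), up, mul_assoc]

/-- The letters `σ` of the smaller turn commute with the larger one. Both letters of `γ = t_1 t_0`
drop by one in passing, which leaves `γ` unchanged. -/
theorem turn_commute {n : ℕ} (hr : n + 3 ≤ r) :
    Commute (turn e r n) (turn e r (n + 1)) := by
  refine .mul_left ?_ (.mul_left ?_ ?_)
  · have : ∀ K ≤ n, Commute (δ K 0) (turn e r (n + 1)) := by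
      intro K hK
      induction K with
      | zero => exact Commute.one_left _
      | succ K ih =>
        rw [dn_succ (Nat.zero_le _)]
        exact .mul_left (S_mul_turn hr (by omega)) (ih (by omega))
    exact this n le_rfl
  · rw [circ, commute_iff_eq, mul_assoc, T_mul_turn hr (by omega), ← mul_assoc,
      T_mul_turn hr (by omega), mul_assoc, sub_self, T_mul_T, circ]
  · have : ∀ K ≤ n, Commute (υ K) (turn e r (n + 1)) := by
      intro K hK
      induction K with
      | zero => exact Commute.one_left _
      | succ K ih => exact .mul_left (ih (by omega)) (S_mul_turn hr (by omega))
    exact this n le_rfl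

/-- Exchanging the last two turns brings a `σ n` next to `delta e r n`, with which it commutes, and
so to the front. -/
theorem delta_add_two {n : ℕ} (hr : n + 3 ≤ r) :
    delta e r (n + 2) = σ n * (delta e r n * turn e r n * σ n * turn e r n) := by
  have h1 := (turn_commute (e := e) hr).eq
  have h2 := (S_commute_of_mem (delta_mem_parabolic (e := e) (r := r) n)).eq
  rw [delta, delta, mul_assoc, h1, turn_succ]
  simp only [← mul_assoc, h2]

theorem S_mul_delta {K n : ℕ} (hr : K + 1 ≤ r) (h : n + 2 ≤ K) :
    Commute (σ n) (delta e r K) := by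
  induction K, h using Nat.le_induction with
  | base =>
    have h2 := (S_commute_of_mem (delta_mem_parabolic (e := e) (r := r) n)).eq
    rw [commute_iff_eq]
    -- On the left `delta` is expanded with `σ n` last, on the right with `σ n` first. The two
    -- products are then the same word.
    conv_lhs => rw [delta, delta, turn_succ]
    rw [delta_add_two hr]
    simp only [mul_assoc]
  | succ K h ih => exact .mul_right (ih (by omega)) (S_mul_turn hr (by omega))

theorem mul_delta {K : ℕ} (hr : r = K + 1) (hK : 1 ≤ K) (x : BraidMonoid e r) :
    x * delta e r K = delta e r K * shift e r (-(K + 1)) x := by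
  induction x using atom_induction with
  | one => simp
  | mul a x ih =>
    rw [mul_assoc, ih, map_mul, ← mul_assoc, ← mul_assoc]
    congr 1
    rcases a with i | ⟨j, h3, hj⟩
    · exact (T_mul_delta hr.ge hK i).trans (by rw [sub_eq_add_neg]; rfl)
    · obtain ⟨j, rfl⟩ : ∃ m, j = m + 3 := ⟨j - 3, by omega⟩
      have := (S_mul_delta (e := e) (r := r) (K := K) (n := j) hr.ge (by omega)).eq
      rw [S, dif_pos hj] at this
      exact this

theorem delta_dvd {K L : ℕ} (h : K ≤ L) : LeftDvd (delta e r K) (delta e r L) := by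
  induction L, h using Nat.le_induction with
  | base => exact ⟨1, mul_one _⟩
  | succ L h ih =>
    obtain ⟨z, hz⟩ := ih
    exact ⟨z * turn e r L, by rw [← mul_assoc, hz, delta]⟩

theorem atom_dvd_delta {K : ℕ} (hr : r = K + 1) (hK : 1 ≤ K) (a : Gen e r) :
    LeftDvd (atom a) (delta e r K) := by
  rcases a with i | ⟨j, h3, hj⟩
  · obtain ⟨z, hz⟩ := delta_dvd (e := e) (r := r) hK
    refine ⟨τ (i - 1) * z, ?_⟩
    rw [← hz, delta_one, ← T_mul_T i, mul_assoc]
    rfl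
  · obtain ⟨j, rfl⟩ : ∃ m, j = m + 3 := ⟨j - 3, by omega⟩
    obtain ⟨z, hz⟩ := delta_dvd (e := e) (r := r) (show j + 2 ≤ K by omega)
    refine ⟨delta e r j * turn e r j * σ j * turn e r j * z, ?_⟩
    rw [← hz, delta_add_two hj, mul_assoc (σ j), S, dif_pos hj]

/-- Every common multiple of `b` and a multiple of `u` comes from `u * b = b * u`. -/
def Crosses (b u : BraidMonoid e r) : Prop :=
  ∀ z w, u * z = b * w → ∃ v, w = u * v ∧ z = b * v

theorem Crosses.one (b : BraidMonoid e r) : Crosses b 1 :=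
  fun z w h => ⟨w, (one_mul _).symm, by simpa using h⟩

theorem Crosses.mul {b u v : BraidMonoid e r} (hu : Crosses b u) (hv : Crosses b v) :
    Crosses b (u * v) := by
  intro z w h
  rw [mul_assoc] at h
  obtain ⟨w', rfl, h'⟩ := hu _ _ h
  obtain ⟨w'', rfl, rfl⟩ := hv _ _ h'
  exact ⟨w'', (mul_assoc _ _ _).symm, rfl⟩

theorem eq_one_of_len_eq_zero {x : BraidMonoid e r} (h : len x = 0) : x = 1 := by
  induction x using atom_induction with
  | one => rfl
  | mul a x _ => simp at h

variable [Nontrivial (ZMod e)]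

/-- Let `φ` be the shift with `x * Δ = Δ * φ x`. From `x * y = Δ`, cancelling `x` gives `Δ = y * φ
x`; applying the inverse of `φ`, which fixes `Δ`, makes `x` a right divisor. The converse needs only
the cancellation. -/
theorem balanced_delta {K : ℕ} (hr : r = K + 1) (hK : 1 ≤ K) (x : BraidMonoid e r) :
    LeftDvd x (delta e r K) ↔ RightDvd x (delta e r K) := by
  constructor
  · rintro ⟨y, hy⟩
    have h1 := mul_delta hr hK x
    rw [← hy, mul_assoc] at h1
    have h2 := congrArg (shift e r (- -(K + 1))) (mul_left_cancel_braid h1)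
    rw [hy, map_mul, shift_delta] at h2
    have h3 := shift_shift_neg (r := r) (- -(K + 1) : ZMod e) x
    rw [neg_neg] at h3 h2
    exact ⟨_, by rw [h2, h3]⟩
  · rintro ⟨y, hy⟩
    have h1 := mul_delta hr hK y
    rw [hy, mul_assoc] at h1
    rw [hy]
    exact ⟨_, (mul_left_cancel_braid h1).symm⟩

theorem crosses_atom {a b : Gen e r} (h : Comm a b) : Crosses (atom a) (atom b) := by
  intro z w hz
  obtain ⟨v, h1, h2⟩ := (res_of_atom_mul_eq hz).of_comm h.symm
  exact ⟨v, h2, h1⟩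

theorem crosses_S_S {m n : ℕ} (hm : m + 3 ≤ r) (h : m + 1 < n ∨ n + 1 < m) :
    Crosses (σ m) (σ n) := by
  by_cases hn : n + 3 ≤ r
  · rw [S, S, dif_pos hm, dif_pos hn]
    exact crosses_atom (by simp only [Comm]; omega)
  · rw [S, S, dif_neg hn]
    exact Crosses.one _

theorem crosses_S_T {m : ℕ} (hm : m + 3 ≤ r) (h : 1 ≤ m) (i : ZMod e) :
    Crosses (σ m) (τ i) := by
  rw [S, dif_pos hm]
  exact crosses_atom (show 4 ≤ m + 3 by omega)

theorem crosses_T_S {m : ℕ} (h : 1 ≤ m) (i : ZMod e) : Crosses (τ i) (σ m) := by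
  unfold S
  split_ifs with hm
  · exact crosses_atom (show 4 ≤ m + 3 by omega)
  · exact Crosses.one _

theorem crosses_parabolic {K : ℕ} (hr : K + 3 ≤ r) {w : BraidMonoid e r}
    (hw : w ∈ parabolic e r K) : Crosses (σ K) w := by
  induction hw using Submonoid.closure_induction with
  | mem y h =>
    obtain ⟨i | n, ha, rfl⟩ := h
    · exact crosses_S_T hr ha i
    · exact crosses_S_S hr (Or.inr ha)
  | one => exact Crosses.one _
  | mul y z _ _ hy hz => exact hy.mul hz

theorem crosses_S_dn {K m n : ℕ} (hm : m + 3 ≤ r) (h : m + 1 < n) : Crosses (σ m) (δ K n) := by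
  induction K with
  | zero => exact Crosses.one _
  | succ K ih =>
    rw [dn]
    split_ifs
    · exact (crosses_S_S hm (Or.inl (by omega))).mul ih
    · exact Crosses.one _

theorem crosses_T_dn {K n : ℕ} (h : 1 ≤ n) (i : ZMod e) : Crosses (τ i) (δ K n) := by
  induction K with
  | zero => exact Crosses.one _
  | succ K ih =>
    rw [dn]
    split_ifs
    · exact (crosses_T_S (by omega) i).mul ih
    · exact Crosses.one _

theorem S_mul_eq_S_mul {m n : ℕ} (hm : m + 3 ≤ r) (hn : n + 3 ≤ r) (h : m + 1 = n ∨ n + 1 = m)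
    {x y : BraidMonoid e r} (hxy : σ m * x = σ n * y) :
    ∃ z, x = σ n * (σ m * z) ∧ y = σ m * (σ n * z) := by
  rw [S, S, dif_pos hm, dif_pos hn] at *
  exact (res_of_atom_mul_eq hxy).of_braid (by simp only [Braided]; omega)

theorem S_mul_eq_T_mul (hr : 3 ≤ r) {i : ZMod e} {x y : BraidMonoid e r}
    (hxy : σ 0 * x = τ i * y) : ∃ z, x = τ i * (σ 0 * z) ∧ y = σ 0 * (τ i * z) := by
  rw [S, dif_pos (by omega)] at *
  exact (res_of_atom_mul_eq hxy).of_braid (show 0 + 3 = 3 from rfl)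

theorem T_mul_eq_T_mul {i j : ZMod e} (h : i ≠ j) {x y : BraidMonoid e r}
    (hxy : τ i * x = τ j * y) : ∃ z, x = τ (i - 1) * z ∧ y = τ (j - 1) * z :=
  (res_of_atom_mul_eq hxy).of_circle h

/-- First step in computing what `σ L` still requires of `w` when it divides `turn e r L * w`. As
the letters of the turn are removed from the left, the requirement grows to `δ (L + 1) 0`, then by
`τ 1`, then to `δ (L + 1) 0 * (γ * υ 1)`, and ends as `turn e r (L + 1)`. -/
theorem dn_dvd_of_dvd_S_mul {K n : ℕ} (hr : K + 2 ≤ r) (h : n + 1 < K) {w : BraidMonoid e r}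
    (hw : LeftDvd (δ K (n + 1)) (σ n * w)) : LeftDvd (δ K n) w := by
  obtain ⟨z, hz⟩ := hw
  rw [dn_eq h, mul_assoc] at hz
  obtain ⟨w', rfl, h1⟩ := crosses_S_dn (by omega) (Nat.lt_succ_self _) _ _ hz
  obtain ⟨p, -, rfl⟩ := S_mul_eq_S_mul (by omega) (by omega) (Or.inr rfl) h1
  exact ⟨p, by rw [dn_eq (by omega : n < K), dn_eq h]; simp only [mul_assoc]⟩

theorem dn_dvd_of_dvd_dn_mul {L n : ℕ} (hr : L + 3 ≤ r) (h : n ≤ L) :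
    ∀ {w : BraidMonoid e r}, LeftDvd (σ L) (δ L n * w) → LeftDvd (δ (L + 1) n) w := by
  induction h using Nat.decreasingInduction with
  | self =>
    intro w hw
    rwa [dn_of_le le_rfl, one_mul, ← mul_one (σ L), ← dn_of_le (K := L) le_rfl,
      ← dn_succ le_rfl] at hw
  | of_succ n h ih =>
    intro w hw
    rw [dn_eq (by omega), mul_assoc] at hw
    exact dn_dvd_of_dvd_S_mul hr (by omega) (ih hw)

theorem dn_T_dvd {K : ℕ} (hr : K + 2 ≤ r) (hK : 1 ≤ K) (i : ZMod e) {w : BraidMonoid e r}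
    (hw : LeftDvd (δ K 0) (τ i * w)) : LeftDvd (δ K 0 * τ i) w := by
  obtain ⟨z, hz⟩ := hw
  rw [dn_eq (by omega : 0 < K), mul_assoc] at hz
  obtain ⟨w', rfl, h1⟩ := crosses_T_dn le_rfl i _ _ hz
  obtain ⟨p, -, rfl⟩ := S_mul_eq_T_mul (by omega) h1
  exact ⟨p, by rw [dn_eq (by omega : 0 < K)]; simp only [mul_assoc]⟩

theorem dn_circ_up_one_dvd {K : ℕ} (hr : K + 2 ≤ r) (hK : 1 ≤ K) {i j : ZMod e} (hij : i ≠ j)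
    {w : BraidMonoid e r} (hw : LeftDvd (δ K 0 * τ i) (τ j * w)) :
    LeftDvd (δ K 0 * (γ * υ 1)) w := by
  obtain ⟨z, hz⟩ := hw
  rw [dn_eq (by omega : 0 < K), mul_assoc, mul_assoc] at hz
  obtain ⟨w', rfl, h1⟩ := crosses_T_dn le_rfl j _ _ hz
  obtain ⟨p, h2, rfl⟩ := S_mul_eq_T_mul (by omega) h1
  obtain ⟨p', -, h3⟩ := T_mul_eq_T_mul hij h2
  obtain ⟨q, rfl, -⟩ := S_mul_eq_T_mul (by omega) h3
  refine ⟨q, ?_⟩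
  rw [dn_eq (by omega : 0 < K), ← T_mul_T j]
  simp only [up, one_mul, mul_assoc]

/-- The letter `σ n` crosses the upper part of the descent and meets `σ (n + 1)`. After the braid
relation and a cancellation, `σ (n + 1)` has to cross `turn e r n`, which it can, and then meets the
last letter `σ n` of `υ (n + 1)`. -/
theorem dn_circ_up_dvd_of_dvd_S_mul {K n : ℕ} (hr : K + 2 ≤ r) (h : n + 1 < K)
    {w : BraidMonoid e r} (hw : LeftDvd (δ K 0 * (γ * υ (n + 1))) (σ n * w)) :
    LeftDvd (δ K 0 * (γ * υ (n + 2))) w := by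
  obtain ⟨z, hz⟩ := hw
  have h0 : δ K 0 = δ K (n + 2) * (σ (n + 1) * (σ n * δ n 0)) := by
    rw [← dn_succ (Nat.zero_le _), ← dn_succ (Nat.zero_le _), dn_mul_dn (by omega)]
  rw [h0, mul_assoc] at hz
  obtain ⟨w', rfl, h1⟩ : ∃ v, w = _ ∧ _ = σ n * v :=
    crosses_S_dn (by omega) (Nat.lt_succ_self _) _ _ ((mul_assoc _ _ _).symm.trans hz)
  simp only [mul_assoc] at h1
  obtain ⟨p, h2, rfl⟩ := S_mul_eq_S_mul (by omega) (by omega) (Or.inr rfl) h1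
  have h3 := mul_left_cancel_braid h2
  have hU : δ n 0 * (γ * υ n) ∈ parabolic e r (n + 1) := turn_mem_parabolic n
  have h4 : δ n 0 * (γ * υ n) * (σ n * z) = σ (n + 1) * p := by
    rw [← h3, up]; simp only [mul_assoc]
  obtain ⟨p', rfl, h5⟩ := crosses_parabolic (by omega) hU _ _ h4
  obtain ⟨q, -, rfl⟩ := S_mul_eq_S_mul (by omega) (by omega) (Or.inl rfl) h5
  refine ⟨q, ?_⟩
  rw [h0, up, up]
  simp only [mul_assoc]

theorem dn_circ_up_dvd {K n : ℕ} (hr : K + 2 ≤ r) (h : n + 1 ≤ K) :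
    ∀ {w : BraidMonoid e r}, LeftDvd (δ K 0 * (γ * υ 1)) (υ n * w) →
      LeftDvd (δ K 0 * (γ * υ (n + 1))) w := by
  induction n with
  | zero => intro w hw; rwa [up, one_mul] at hw
  | succ n ih =>
    intro w hw
    rw [show υ (n + 1) = υ n * σ n from rfl, mul_assoc] at hw
    exact dn_circ_up_dvd_of_dvd_S_mul hr (by omega) (ih (by omega) hw)

theorem turn_dvd {L : ℕ} (hr : L + 3 ≤ r) {w : BraidMonoid e r}
    (hw : LeftDvd (σ L) (turn e r L * w)) : LeftDvd (turn e r (L + 1)) w := by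
  rw [turn, mul_assoc] at hw
  have h1 := dn_dvd_of_dvd_dn_mul hr (Nat.zero_le L) hw
  rw [circ, mul_assoc, mul_assoc] at h1
  have h2 := dn_circ_up_one_dvd hr (by omega) one_ne_zero (dn_T_dvd hr (by omega) 1 h1)
  exact dn_circ_up_dvd hr le_rfl h2

/-- The element `delta e r K` is a least common multiple of the generators it involves. -/
theorem delta_dvd_of_atoms_dvd {K : ℕ} (hr : K + 1 ≤ r) {d : BraidMonoid e r}
    (h : ∀ a : Gen e r, LeftDvd (atom a) d) : LeftDvd (delta e r K) d := by
  induction K with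
  | zero => exact ⟨d, one_mul d⟩
  | succ K ih =>
    rcases K with _ | L
    · obtain ⟨x, hx⟩ := h (.t 1)
      obtain ⟨y, hy⟩ := h (.t 0)
      obtain ⟨z, hz, -⟩ := T_mul_eq_T_mul one_ne_zero (hx.trans hy.symm)
      refine ⟨z, ?_⟩
      rw [delta_one, ← hx, hz, sub_self, circ, mul_assoc]
      rfl
    · obtain ⟨w, rfl⟩ := ih (by omega)
      obtain ⟨y, hy⟩ := h (.s (L + 3) (by omega) (by omega))
      have hS : σ L = atom (.s (L + 3) (by omega) (by omega)) := by rw [S, dif_pos]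
      rw [← hS, delta, mul_assoc] at hy
      -- Since `σ L` crosses `delta e r L`, it must divide `turn e r L * w`.
      obtain ⟨v, -, hv⟩ := crosses_parabolic (by omega) (delta_mem_parabolic L) _ _ hy.symm
      obtain ⟨u, rfl⟩ := turn_dvd (by omega) ⟨v, hv.symm⟩
      exact ⟨u, by rw [delta, mul_assoc]⟩

end GarsideElement

/-! ### The simples and their length polynomial -/

section Simples

variable {e r : ℕ}

theorem LeftDvd.trans {M : Type*} [Monoid M] {x y z : M} (h1 : LeftDvd x y) (h2 : LeftDvd y z) :
    LeftDvd x z := by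
  obtain ⟨u, rfl⟩ := h1
  obtain ⟨v, rfl⟩ := h2
  exact ⟨u * v, (mul_assoc _ _ _).symm⟩

/-- An atom in a generated submonoid is one of the generators. -/
theorem mem_of_mem_closure {D : Set (BraidMonoid e r)} {x : BraidMonoid e r}
    (hx : x ∈ Submonoid.closure D) : len x = 1 → x ∈ D := by
  induction hx using Submonoid.closure_induction with
  | mem x h => exact fun _ => h
  | one => simp
  | mul x y _ _ hx hy =>
    intro h
    rw [len_mul] at h
    rcases (show len x = 0 ∧ len y = 1 ∨ len x = 1 ∧ len y = 0 by omega) with ⟨h1, h2⟩ | ⟨h1, h2⟩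
    · rw [eq_one_of_len_eq_zero h1, one_mul]
      exact hy h2
    · rw [eq_one_of_len_eq_zero h2, mul_one]
      exact hx h1

/-- An atom has length 1, so it can lie in the submonoid generated by the divisors only by being one
of them. -/
theorem IsGarsideElement.atom_dvd {d : BraidMonoid e r} (h : IsGarsideElement d) (a : Gen e r) :
    LeftDvd (atom a) d :=
  mem_of_mem_closure (h.generate ▸ Submonoid.mem_top _) (len_atom a)

theorem eval_simplesPoly (h : (simples (BraidMonoid e r)).Finite) :
    (simplesPoly e r).eval 1 = (simples (BraidMonoid e r)).ncard := by
  classical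
  obtain ⟨F, hF⟩ := h.exists_finset_coe
  have h1 : ∀ n, numSimplesOfLength e r n = (F.filter (len · = n)).card := by
    intro n
    rw [numSimplesOfLength, ← hF, ← Set.ncard_coe_finset]
    congr 1
    ext x
    simp only [Finset.coe_filter]
    rfl
  -- The `finsum` is a genuine finite sum: its support lies in the set of lengths of simples.
  have h2 : simplesPoly e r =
      ∑ n ∈ F.image len, Polynomial.monomial n (numSimplesOfLength e r n) := by
    refine finsum_eq_sum_of_support_subset _ ?_
    intro n hn
    by_contra h
    apply hn
    change Polynomial.monomial n (numSimplesOfLength e r n) = 0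
    rw [h1, Finset.card_eq_zero.2, map_zero]
    rw [Finset.filter_eq_empty_iff]
    intro x hx hxn
    exact h (by simpa using ⟨x, hx, hxn⟩)
  rw [h2, Polynomial.eval_finsetSum, ← hF, Set.ncard_coe_finset,
    Finset.card_eq_sum_card_image len F]
  refine Finset.sum_congr rfl fun n _ => ?_
  simp [h1]

variable [NeZero e] [Nontrivial (ZMod e)] {K : ℕ}

theorem isGarsideElement_delta (hr : r = K + 1) (hK : 1 ≤ K) :
    IsGarsideElement (delta e r K) where
  balanced := balanced_delta hr hK
  finite := finite_leftDvd_delta hr hK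
  generate := by
    rw [eq_top_iff]
    intro x _
    induction x using atom_induction with
    | one => exact one_mem _
    | mul a x ih => exact mul_mem (Submonoid.subset_closure (atom_dvd_delta hr hK a)) (ih trivial)

theorem isMinimalGarsideElement_delta (hr : r = K + 1) (hK : 1 ≤ K) :
    IsMinimalGarsideElement (delta e r K) :=
  ⟨isGarsideElement_delta hr hK, fun _ hd => delta_dvd_of_atoms_dvd hr.ge hd.atom_dvd⟩

theorem simples_eq (hr : r = K + 1) (hK : 1 ≤ K) :
    simples (BraidMonoid e r) = {x | LeftDvd x (delta e r K)} := by
  ext x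
  constructor
  · rintro ⟨d, hd, hx⟩
    exact hx.trans (hd.2 _ (isGarsideElement_delta hr hK))
  · exact fun hx => ⟨_, isMinimalGarsideElement_delta hr hK, hx⟩

end Simples

/-! ### A lower bound for the order of the reflection group -/

section ReflectionGroup

/-- The monomial matrix of a permutation and a family of coefficients. -/
def monomialMatrix {r : ℕ} (π : Equiv.Perm (Fin r)) (c : Fin r → ℂ) : Matrix (Fin r) (Fin r) ℂ :=
  fun i j => if j = π i then c i else 0

theorem finite_reflectionGroup {e : ℕ} (r : ℕ) (he : 0 < e) : (reflectionGroup e r).Finite := by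
  have hf : {z : ℂ | z = 0 ∨ z ^ e = 1}.Finite := by
    rw [Set.ofPred_or]
    refine (Set.finite_singleton 0).union ?_
    have := Polynomial.nthRootsFinset e (1 : ℂ) |>.finite_toSet
    refine this.subset fun z hz => ?_
    simpa [Polynomial.mem_nthRootsFinset he] using hz
  refine (Set.Finite.pi' fun _ => Set.Finite.pi' fun _ => hf).subset ?_
  intro x hx i j
  by_cases h : x i j = 0
  · exact Or.inl h
  · exact Or.inr (hx.2.2.1 i j h)

theorem monomialMatrix_mem {e r : ℕ} {π : Equiv.Perm (Fin r)} {c : Fin r → ℂ}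
    (h0 : ∀ i, c i ≠ 0) (h1 : ∀ i, c i ^ e = 1) (h2 : ∏ i, c i = 1) :
    monomialMatrix π c ∈ reflectionGroup e r := by
  refine ⟨fun i => ⟨π i, by simp [monomialMatrix, h0], by simp [monomialMatrix, h0]⟩,
    fun j => ⟨π.symm j, by simp [monomialMatrix, h0], ?_⟩, ?_, ?_⟩
  · intro i h
    simp [monomialMatrix, h0] at h
    simp [h]
  · intro i j h
    simp [monomialMatrix] at h ⊢
    simp [h, h1]
  · rw [Finset.prod_filter, Fintype.prod_prod_type]
    refine Eq.trans ?_ h2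
    refine Finset.prod_congr rfl fun i _ => ?_
    rw [Finset.prod_eq_single (π i)]
    · simp [monomialMatrix, h0]
    · intro j _ hj
      simp [monomialMatrix, hj]
    · simp

theorem monomialMatrix_injective {r : ℕ} {π π' : Equiv.Perm (Fin r)} {c c' : Fin r → ℂ}
    (h0 : ∀ i, c i ≠ 0) (h : monomialMatrix π c = monomialMatrix π' c') : π = π' ∧ c = c' := by
  have h1 : ∀ i, π i = π' i := by
    intro i
    by_contra hi
    have := congrFun (congrFun h i) (π i)
    simp [monomialMatrix, hi, h0] at this
  obtain rfl := Equiv.ext h1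
  refine ⟨rfl, funext fun i => ?_⟩
  simpa [monomialMatrix] using congrFun (congrFun h i) (π i)

/-- The permutation and all coefficients except the one of row 0 are free; that one is the inverse
of the product of the others. -/
theorem card_le_ncard_reflectionGroup {e : ℕ} (n : ℕ) (he : 0 < e) :
    (n + 1).factorial * e ^ n ≤ (reflectionGroup e (n + 1)).ncard := by
  have : NeZero e := ⟨he.ne'⟩
  let coeff : (Fin n → rootsOfUnity e ℂ) → Fin (n + 1) → ℂ := fun c =>
    Fin.cons (((∏ i, c i)⁻¹ : rootsOfUnity e ℂ) : ℂˣ) fun i => ((c i : ℂˣ) : ℂ)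
  have h0 : ∀ c i, coeff c i ≠ 0 := by
    intro c i
    refine Fin.cases ?_ (fun i => ?_) i <;> simp [coeff, Finset.prod_ne_zero_iff]
  have h1 : ∀ c i, coeff c i ^ e = 1 := by
    intro c i
    have h : ∀ z : rootsOfUnity e ℂ, (((z : ℂˣ) : ℂ)) ^ e = 1 := fun z => by
      have := (mem_rootsOfUnity' e _).1 z.2
      simpa using this
    refine Fin.cases ?_ (fun i => ?_) i
    · exact h _
    · exact h _
  have h2 : ∀ c, ∏ i, coeff c i = 1 := by
    intro c
    rw [Fin.prod_univ_succ]
    simp only [coeff, Fin.cons_zero, Fin.cons_succ]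
    rw [← Units.coe_prod, ← Units.val_mul, ← Subgroup.val_finsetProd, ← Subgroup.coe_mul,
      inv_mul_cancel, Subgroup.coe_one, Units.val_one]
  let f : Equiv.Perm (Fin (n + 1)) × (Fin n → rootsOfUnity e ℂ) → reflectionGroup e (n + 1) :=
    fun p => ⟨monomialMatrix p.1 (coeff p.2), monomialMatrix_mem (h0 _) (h1 _) (h2 _)⟩
  have hf : Function.Injective f := by
    rintro ⟨π, c⟩ ⟨π', c'⟩ h
    obtain ⟨rfl, h⟩ := monomialMatrix_injective (h0 _) (Subtype.mk.inj h)
    congr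
    funext i
    have := congrFun h i.succ
    exact Subtype.ext (Units.ext (by simpa [coeff] using this))
  have := (finite_reflectionGroup (n + 1) he).to_subtype
  have hc := Nat.card_le_card_of_injective f hf
  rw [Nat.card_prod, Nat.card_eq_fintype_card, Fintype.card_perm, Fintype.card_fin, Nat.card_fun,
    Complex.card_rootsOfUnity, Nat.card_fin] at hc
  exact hc

end ReflectionGroup

end CorranPicantin

/-! ### The formulas and the strict inequality -/

theorem corollary3p9 (e r : ℕ) (he : 2 ≤ e) (hr : 2 ≤ r) :
    (CorranPicantin.simples (CorranPicantin.BraidMonoid e r)).Finite ∧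
    (CorranPicantin.simples (CorranPicantin.BraidMonoid e r)).ncard =
      (CorranPicantin.simplesPoly e r).eval 1 ∧
    (CorranPicantin.simplesPoly e r).eval 1 = ∏ k ∈ Finset.Icc 2 r, (2 * (k - 1) + e) ∧
    (((CorranPicantin.simplesPoly e r).eval 1 : ℕ) : ℚ) =
      (Nat.doubleFactorial (2 * (r - 1) + e) : ℚ) / (Nat.doubleFactorial e : ℚ) ∧
    (2 < e →
      (CorranPicantin.simples (CorranPicantin.BraidMonoid e r)).ncard <
        (CorranPicantin.reflectionGroup e r).ncard) := by
  obtain ⟨K, rfl⟩ : ∃ K, r = K + 1 := ⟨r - 1, by omega⟩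
  have hK : 1 ≤ K := by omega
  have : NeZero e := ⟨by omega⟩
  have : Fact (1 < e) := ⟨by omega⟩
  have hs := CorranPicantin.simples_eq (e := e) (r := K + 1) rfl hK
  have hfin := CorranPicantin.finite_leftDvd_delta (e := e) (r := K + 1) rfl hK
  have hcard := CorranPicantin.ncard_leftDvd_delta (e := e) (r := K + 1) rfl hK
  rw [← hs] at hfin hcard
  have heval := CorranPicantin.eval_simplesPoly hfin
  refine ⟨hfin, heval.symm, ?_, ?_, fun he' => ?_⟩
  · rw [heval, hcard]
    clear * -
    induction K with
    | zero => simp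
    | succ K ih => rw [Finset.prod_range_succ, ih, Finset.prod_Icc_succ_top (b := K + 1) (by omega)]; rfl
  · rw [heval, hcard]
    have hd : ∀ K, (∏ k ∈ Finset.range K, (2 * (k + 1) + e)) * Nat.doubleFactorial e =
        Nat.doubleFactorial (2 * K + e) := by
      intro K
      induction K with
      | zero => simp
      | succ K ih =>
        rw [Finset.prod_range_succ, mul_right_comm, ih,
          show 2 * (K + 1) + e = 2 * K + e + 2 by ring, Nat.doubleFactorial, mul_comm]
    rw [eq_div_iff (by exact_mod_cast (Nat.doubleFactorial_pos e).ne'), Nat.add_sub_cancel, ← hd]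
    push_cast
    rfl
  · rw [hcard]
    refine lt_of_lt_of_le ?_ (CorranPicantin.card_le_ncard_reflectionGroup K (by omega))
    have hp : (K + 1).factorial * e ^ K = ∏ k ∈ Finset.range K, ((k + 2) * e) := by
      rw [Finset.prod_mul_distrib, Finset.prod_const, Finset.card_range,
        ← Finset.prod_range_add_one_eq_factorial, Finset.prod_range_succ']
      simp
    rw [hp]
    refine Finset.prod_lt_prod_of_nonempty (fun _ _ => by omega) (fun k _ => ?_) ?_
    -- The difference of the factors is `(k + 2) * e - (2 * (k + 1) + e) = (k + 1) * (e - 2)`,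
    -- positive for `e > 2`.
    · nlinarith
    · simpa using by omega
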